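/- A metrized graph $\Gamma$ is a connected space obtained from finitely many segments $[0,L_e]$, $L_e>0$, by gluing along finitely many points, i.e. a finite connected graph with parametrized edges (multiple edges and self-loops allowed); $dx$ denotes the length measure on it. For $y,z\in\Gamma$ let $x\mapsto j_z(x,y)$ be the voltage function: the unique continuous function on $\Gamma$, affine in the parameter off a finite set of points, that vanishes at $x=z$ and satisfies $\Delta_x j_z(x,y)=\delta_y(x)-\delta_z(x)$, where $\Delta f=-f''(x)\,dx-\sum_{p}\big[\sum_{\vec v\text{ at }p}d_{\vec v}f(p)\big]\delta_p$, the inner sum being over the directions emanating from $p$. Let $r(x,y)=j_x(y,y)$ be the resistance function. There is a unique real-valued signed Borel measure $\mu$ on $\Gamma$ with $\mu(\Gamma)=1$ (the canonical measure) such that $\int_\Gamma j_\zeta(x,x)\,d\mu(\zeta)$ does not depend on $x\in\Gamma$; the tau constant is $$\tau(\Gamma)=\frac12\int_\Gamma j_\zeta(x,x)\,d\mu(\zeta).$$ For $p,q\in\Gamma$ put $$A_{p,q,\Gamma}=\int_\Gamma j_x(p,q)\Big(\frac{d}{dx}j_p(x,q)\Big)^2dx .$$ Let $\Gamma_1$ and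 $\Gamma_2$ be metrized graphs with resistance functions $r_1$ and $r_2$, let $p\ne q$ be two distinct points of $\Gamma_1$ and also of $\Gamma_2$, and let $\Gamma_1\cup\Gamma_2$ be the metrized graph obtained by gluing $\Gamma_1$ and $\Gamma_2$ along $p$ and $q$ (identifying $p\in\Gamma_1$ with $p\in\Gamma_2$ and $q\in\Gamma_1$ with $q\in\Gamma_2$), so that $\Gamma_1\cap\Gamma_2=\{p,q\}$. Then $$\tau(\Gamma_1\cup\Gamma_2)=\tau(\Gamma_1)+\tau(\Gamma_2)-\frac{r_1(p,q)+r_2(p,q)}{6}+\frac{A_{p,q,\Gamma_1}+A_{p,q,\Gamma_2}}{r_1(p,q)+r_2(p,q)} .$$ -/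

import Mathlib

open MeasureTheory Filter Topology

universe u

/-- A metrized graph, presented as the space `Point` obtained from finitely many closed segments
`[0, len e]` by gluing along finitely many points, the result being connected.

The map `proj` sends the point with parameter `t` on the segment `e` to the corresponding point of
the graph. No vertex set is singled out: any finite set of points that contains the ends of the
segments and the points at which gluing takes place may serve as one, and cutting the segments
there gives the edges, with their parametrizations. A finite connected graph with parametrized
edges (multiple edges and self-loops allowed) is the case in which only ends are glued. -/
structure MetrizedGraph where
  /-- the index set of the segments -/
  Edge : Type u
  [fintypeEdge : Fintype Edge]
  /-- the lengths of the segments -/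
  len : Edge → ℝ
  len_pos : ∀ e, 0 < len e
  /-- the points of the graph -/
  Point : Type u
  /-- the gluing map -/
  proj : (Σ e, Set.Icc (0 : ℝ) (len e)) → Point
  proj_surjective : Function.Surjective proj
  finite_glued : {a | ∃ b, b ≠ a ∧ proj b = proj a}.Finite
  connectedSpace : @ConnectedSpace Point (TopologicalSpace.coinduced proj inferInstance)

attribute [instance] MetrizedGraph.fintypeEdge

noncomputable section

namespace MetrizedGraph

/-- The quotient topology. -/
instance (Γ : MetrizedGraph.{u}) : TopologicalSpace Γ.Point :=
  TopologicalSpace.coinduced Γ.proj inferInstance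

instance (Γ : MetrizedGraph.{u}) : ConnectedSpace Γ.Point := Γ.connectedSpace

instance (Γ : MetrizedGraph.{u}) : MeasurableSpace Γ.Point := borel Γ.Point

instance (Γ : MetrizedGraph.{u}) : BorelSpace Γ.Point := ⟨rfl⟩

/-- The parametrization `t ↦ path e t`, `0 ≤ t ≤ len e`, of the segment `e` (extended to all real
`t` by constants, which is only for convenience). -/
def path (Γ : MetrizedGraph.{u}) (e : Γ.Edge) (t : ℝ) : Γ.Point :=
  Γ.proj ⟨e, Set.projIcc 0 (Γ.len e) (Γ.len_pos e).le t⟩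

/-- The sum, over all directions emanating from the point `x`, of the directional derivatives
of `f` at `x`. A segment `e` contributes a forward direction for each `t ∈ [0, len e)` and a backward
direction for each `t ∈ (0, len e]` with `path e t = x`. -/
def slopeSum (Γ : MetrizedGraph.{u}) (f : Γ.Point → ℝ) (x : Γ.Point) : ℝ :=
  ∑ e, ((∑ᶠ t ∈ {t | t ∈ Set.Ico 0 (Γ.len e) ∧ Γ.path e t = x},
          derivWithin (fun s => f (Γ.path e s)) (Set.Ici t) t)
      + ∑ᶠ t ∈ {t | t ∈ Set.Ioc 0 (Γ.len e) ∧ Γ.path e t = x},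
          -derivWithin (fun s => f (Γ.path e s)) (Set.Iic t) t)

open Classical in
/-- `f` is the voltage on `Γ`, viewed as a resistive circuit whose resistances are the lengths, when
unit current enters at `y` and exits at `z`, with reference voltage `0` at `z`. That is, `f` is the
solution of `Δ f = δ_y - δ_z`, `f z = 0`, where `Δ f = -f'' dx - ∑ₓ (slopeSum f x) δₓ`:
`f` is continuous, `f'' = 0` (`f` is locally affine) off a finite set of points, and the outgoing
slopes sum to `0` at every point, except for a deficit of `1` at `y` and an excess of `1` at `z`. -/
structure IsVoltage (Γ : MetrizedGraph.{u}) (z y : Γ.Point) (f : Γ.Point → ℝ) : Prop where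
  continuous : Continuous f
  locally_affine : ∃ S : Set Γ.Point, S.Finite ∧
    ∀ e, ∀ t ∈ Set.Ioo 0 (Γ.len e), Γ.path e t ∉ S →
      ∃ a b : ℝ, ∀ᶠ s in 𝓝 t, f (Γ.path e s) = a + b * s
  slopeSum_eq : ∀ x, Γ.slopeSum f x = (if x = z then 1 else 0) - (if x = y then 1 else 0)
  ground : f z = 0

open Classical in
/-- The voltage function `j_z(x, y)`. -/
def voltage (Γ : MetrizedGraph.{u}) (z x y : Γ.Point) : ℝ :=
  if h : ∃ f, Γ.IsVoltage z y f then h.choose x else 0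

/-- The (effective) resistance function `r(x, y) = j_x(y, y)`. -/
def resistance (Γ : MetrizedGraph.{u}) (x y : Γ.Point) : ℝ := Γ.voltage x y y

/-- `j_μ(x, y) = ∫ j_ζ(x, y) dμ(ζ)` for a signed Borel measure `μ`. -/
def measureVoltage (Γ : MetrizedGraph.{u}) (μ : SignedMeasure Γ.Point) (x y : Γ.Point) : ℝ :=
  ∫ᵛ ζ, Γ.voltage ζ x y ∂•μ

/-- `μ` is a canonical measure: a signed Borel measure of total mass `1` for which `j_μ(x, x)` is
constant on `Γ`. -/
def IsCanonicalMeasure (Γ : MetrizedGraph.{u}) (μ : SignedMeasure Γ.Point) : Prop :=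
  μ Set.univ = 1 ∧ ∀ x x', Γ.measureVoltage μ x x = Γ.measureVoltage μ x' x'

open Classical in
/-- The tau constant: the constant value of `j_μ(x, x) / 2`, where `μ` is the canonical measure. -/
def tau (Γ : MetrizedGraph.{u}) : ℝ :=
  if h : ∃ c, ∃ μ, Γ.IsCanonicalMeasure μ ∧ ∀ x, 1 / 2 * Γ.measureVoltage μ x x = c
  then h.choose else 0

/-- `A_{p,q,Γ} = ∫_Γ j_x(p, q) (d/dx j_p(x, q))² dx`. -/
def A (Γ : MetrizedGraph.{u}) (p q : Γ.Point) : ℝ :=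
  ∑ e, ∫ t in (0 : ℝ)..Γ.len e,
    Γ.voltage (Γ.path e t) p q * deriv (fun s => Γ.voltage p (Γ.path e s) q) t ^ 2

lemma finite_fiber (Γ : MetrizedGraph.{u}) (x : Γ.Point) : {a | Γ.proj a = x}.Finite := by
  by_cases h : ({a | Γ.proj a = x} : Set _).Subsingleton
  · exact h.finite
  · refine Γ.finite_glued.subset fun a ha => ?_
    by_contra hc
    refine h fun b hb c hc' => ?_
    have key : ∀ d, Γ.proj d = x → d = a := fun d hd => by
      by_contra hne
      exact hc ⟨d, hne, hd.trans (Eq.symm ha)⟩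
    rw [key b hb, key c hc']

lemma continuous_proj (Γ : MetrizedGraph.{u}) : Continuous Γ.proj := continuous_coinduced_rng

section Union

variable (Γ₁ Γ₂ : MetrizedGraph.{u}) {p₁ q₁ : Γ₁.Point} {p₂ q₂ : Γ₂.Point}

/-- The equivalence relation on the disjoint union of `Γ₁` and `Γ₂` that identifies `p₁` with `p₂`,
and `q₁` with `q₂`, and nothing else. -/
def unionSetoid (h₁ : p₁ ≠ q₁) (h₂ : p₂ ≠ q₂) : Setoid (Γ₁.Point ⊕ Γ₂.Point) where
  r a b := a = b ∨ (a = .inl p₁ ∧ b = .inr p₂) ∨ (a = .inr p₂ ∧ b = .inl p₁) ∨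
    (a = .inl q₁ ∧ b = .inr q₂) ∨ (a = .inr q₂ ∧ b = .inl q₁)
  iseqv := by
    refine ⟨fun _ => .inl rfl, ?_, ?_⟩
    · grind
    · grind

/-- The gluing map of the union of `Γ₁` and `Γ₂` along two points. -/
def unionProj (h₁ : p₁ ≠ q₁) (h₂ : p₂ ≠ q₂) :
    (Σ e : Γ₁.Edge ⊕ Γ₂.Edge, Set.Icc (0 : ℝ) (Sum.elim Γ₁.len Γ₂.len e)) →
      Quotient (unionSetoid Γ₁ Γ₂ h₁ h₂)
  | ⟨.inl e, t⟩ => ⟦.inl (Γ₁.proj ⟨e, t⟩)⟧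
  | ⟨.inr e, t⟩ => ⟦.inr (Γ₂.proj ⟨e, t⟩)⟧

/-- The union `Γ₁ ∪ Γ₂` along two points: the graph obtained from the disjoint union of `Γ₁` and `Γ₂`
by identifying `p₁` with `p₂` and `q₁` with `q₂`. -/
def union (h₁ : p₁ ≠ q₁) (h₂ : p₂ ≠ q₂) : MetrizedGraph.{u} where
  Edge := Γ₁.Edge ⊕ Γ₂.Edge
  len := Sum.elim Γ₁.len Γ₂.len
  len_pos := by
    rintro (e | e)
    · exact Γ₁.len_pos e
    · exact Γ₂.len_pos e
  Point := Quotient (unionSetoid Γ₁ Γ₂ h₁ h₂)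
  proj := unionProj Γ₁ Γ₂ h₁ h₂
  proj_surjective := by
    intro x
    induction x using Quotient.inductionOn with
    | h x =>
      rcases x with x | x
      · obtain ⟨⟨e, t⟩, rfl⟩ := Γ₁.proj_surjective x
        exact ⟨⟨.inl e, t⟩, rfl⟩
      · obtain ⟨⟨e, t⟩, rfl⟩ := Γ₂.proj_surjective x
        exact ⟨⟨.inr e, t⟩, rfl⟩
  finite_glued := by
    let i₁ : (Σ e, Set.Icc (0 : ℝ) (Γ₁.len e)) →
        (Σ e : Γ₁.Edge ⊕ Γ₂.Edge, Set.Icc (0 : ℝ) (Sum.elim Γ₁.len Γ₂.len e)) :=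
      fun a => ⟨.inl a.1, a.2⟩
    let i₂ : (Σ e, Set.Icc (0 : ℝ) (Γ₂.len e)) →
        (Σ e : Γ₁.Edge ⊕ Γ₂.Edge, Set.Icc (0 : ℝ) (Sum.elim Γ₁.len Γ₂.len e)) :=
      fun a => ⟨.inr a.1, a.2⟩
    refine (((Γ₁.finite_glued.union ((Γ₁.finite_fiber p₁).union (Γ₁.finite_fiber q₁))).image
      i₁).union ((Γ₂.finite_glued.union ((Γ₂.finite_fiber p₂).union
      (Γ₂.finite_fiber q₂))).image i₂)).subset ?_
    rintro ⟨a, s⟩ ⟨⟨b, t⟩, hne, hab⟩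
    rcases a with a | a <;> rcases b with b | b
    · refine .inl ⟨⟨a, s⟩, .inl ⟨⟨b, t⟩, fun h => hne (congrArg i₁ h), ?_⟩, rfl⟩
      rcases Quotient.exact hab with h | h | h | h | h <;> simp_all
    · refine .inl ⟨⟨a, s⟩, .inr ?_, rfl⟩
      rcases Quotient.exact hab with h | h | h | h | h <;> simp_all
    · refine .inr ⟨⟨a, s⟩, .inr ?_, rfl⟩
      rcases Quotient.exact hab with h | h | h | h | h <;> simp_all
    · refine .inr ⟨⟨a, s⟩, .inl ⟨⟨b, t⟩, fun h => hne (congrArg i₂ h), ?_⟩, rfl⟩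
      rcases Quotient.exact hab with h | h | h | h | h <;> simp_all
  connectedSpace := by
    let _ : TopologicalSpace (Quotient (unionSetoid Γ₁ Γ₂ h₁ h₂)) :=
      TopologicalSpace.coinduced (unionProj Γ₁ Γ₂ h₁ h₂) inferInstance
    have hπ : Continuous (unionProj Γ₁ Γ₂ h₁ h₂) := continuous_coinduced_rng
    let k₁ : Γ₁.Point → Quotient (unionSetoid Γ₁ Γ₂ h₁ h₂) := fun x => ⟦.inl x⟧
    let k₂ : Γ₂.Point → Quotient (unionSetoid Γ₁ Γ₂ h₁ h₂) := fun x => ⟦.inr x⟧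
    have hk₁ : Continuous k₁ := continuous_coinduced_dom.2 <| continuous_sigma fun e =>
      hπ.comp (continuous_sigmaMk (σ := fun e : Γ₁.Edge ⊕ Γ₂.Edge =>
        Set.Icc (0 : ℝ) (Sum.elim Γ₁.len Γ₂.len e)) (i := .inl e))
    have hk₂ : Continuous k₂ := continuous_coinduced_dom.2 <| continuous_sigma fun e =>
      hπ.comp (continuous_sigmaMk (σ := fun e : Γ₁.Edge ⊕ Γ₂.Edge =>
        Set.Icc (0 : ℝ) (Sum.elim Γ₁.len Γ₂.len e)) (i := .inr e))
    have hpp : k₁ p₁ = k₂ p₂ := Quotient.sound (.inr (.inl ⟨rfl, rfl⟩))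
    have hU : Set.range k₁ ∪ Set.range k₂ = Set.univ := by
      refine Set.eq_univ_of_forall fun x => ?_
      induction x using Quotient.inductionOn with
      | h x =>
        rcases x with x | x
        · exact .inl ⟨x, rfl⟩
        · exact .inr ⟨x, rfl⟩
    refine connectedSpace_iff_univ.2 (hU ▸ IsConnected.union
      ⟨k₁ p₁, ⟨p₁, rfl⟩, ⟨p₂, hpp.symm⟩⟩ (isConnected_range hk₁) (isConnected_range hk₂))

end Union

end MetrizedGraph

end

/-! Write E(f, g) for the integral of f' g' over the graph. Integration by parts turns the equation
of the voltage j_z(·, y) into the weak form E(j_z(·, y), g) = g(y) - g(z) for every continuous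
piecewise polynomial g (`IsVoltage.energy_eq`). Together with the value 0 at z this determines the
voltage (`eq_voltage_of_energy_eq`), because zero energy forces a function to be constant; existence
is a dimension count.

For any base point y, the measure ½ Δr(y, ·) + δ_y is canonical. Integrating the resistance against
it and against an arbitrary canonical measure, in both orders, gives τ = ¼ E(r(y, ·), r(y, ·)), so
uniqueness of the canonical measure is not needed (`tau_eq`).

Take y = p in the union, and put u_i = j_p(·, q) on Γ_i, r_i = r_i(p, q), R = r_1 + r_2. When unit
current enters at x in Γ_i and leaves at p, some of it passes through q and the other graph;
matching the potentials at q shows that the resistance from p becomes r_i(p, x) - u_i(x)²/R on Γ_i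
(`IsGluing.resistance_eq`). The energy of the union is the sum of those of the two graphs. Expanding
the square, every term except E(r_i(p, ·), r_i(p, ·)) = 4τ_i is found by testing polynomials in u_i
and r_i(p, ·) against u_i, up to one integral that is expressed through A_i
(`energy_resistance_sub`). Thus Γ_i contributes τ_i - r_i²/(2R) + A_i/R + r_i³/(3R²), and -(r_1² +
r_2²)/(2R) + (r_1³ + r_2³)/(3R²) = -R/6. -/

noncomputable section

/-! ### Piecewise polynomial functions on an interval. -/

section RealLine

open Polynomial

/-- Near `t`, the function `φ` agrees with a polynomial. -/
def PolyAt (φ : ℝ → ℝ) (t : ℝ) : Prop := ∃ P : ℝ[X], ∀ᶠ s in 𝓝 t, φ s = P.eval s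

/-- Near `t`, the function `φ` is affine. -/
def AffineNear (φ : ℝ → ℝ) (t : ℝ) : Prop := ∃ a b : ℝ, ∀ᶠ s in 𝓝 t, φ s = a + b * s

lemma AffineNear.polyAt {φ : ℝ → ℝ} {t : ℝ} (h : AffineNear φ t) : PolyAt φ t := by
  obtain ⟨a, b, h⟩ := h
  exact ⟨C a + C b * X, by simpa using h⟩

lemma AffineNear.add {φ ψ : ℝ → ℝ} {t : ℝ} (h : AffineNear φ t) (h' : AffineNear ψ t) :
    AffineNear (fun s => φ s + ψ s) t := by
  obtain ⟨a, b, h⟩ := h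
  obtain ⟨a', b', h'⟩ := h'
  refine ⟨a + a', b + b', ?_⟩
  filter_upwards [h, h'] with s h1 h2
  rw [h1, h2]; ring

lemma AffineNear.const_mul {φ : ℝ → ℝ} {t : ℝ} (c : ℝ) (h : AffineNear φ t) :
    AffineNear (fun s => c * φ s) t := by
  obtain ⟨a, b, h⟩ := h
  refine ⟨c * a, c * b, ?_⟩
  filter_upwards [h] with s h1
  rw [h1]; ring

lemma affineNear_const (c t : ℝ) : AffineNear (fun _ => c) t := ⟨c, 0, by simp⟩

lemma PolyAt.add {φ ψ : ℝ → ℝ} {t : ℝ} (h : PolyAt φ t) (h' : PolyAt ψ t) :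
    PolyAt (fun s => φ s + ψ s) t := by
  obtain ⟨P, h⟩ := h
  obtain ⟨Q, h'⟩ := h'
  refine ⟨P + Q, ?_⟩
  filter_upwards [h, h'] with s h1 h2
  simp [h1, h2]

lemma PolyAt.mul {φ ψ : ℝ → ℝ} {t : ℝ} (h : PolyAt φ t) (h' : PolyAt ψ t) :
    PolyAt (fun s => φ s * ψ s) t := by
  obtain ⟨P, h⟩ := h
  obtain ⟨Q, h'⟩ := h'
  refine ⟨P * Q, ?_⟩
  filter_upwards [h, h'] with s h1 h2
  simp [h1, h2]

lemma polyAt_const (c t : ℝ) : PolyAt (fun _ => c) t := ⟨C c, by simp⟩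

lemma PolyAt.differentiableAt {φ : ℝ → ℝ} {t : ℝ} (h : PolyAt φ t) : DifferentiableAt ℝ φ t := by
  obtain ⟨P, h⟩ := h
  exact (P.differentiable t).congr_of_eventuallyEq h

lemma AffineNear.deriv_deriv {φ : ℝ → ℝ} {t : ℝ} (h : AffineNear φ t) :
    deriv (deriv φ) t = 0 := by
  obtain ⟨a, b, h⟩ := h
  have h1 : deriv φ =ᶠ[𝓝 t] fun _ => b := by
    filter_upwards [h.eventually_nhds] with s hs
    have hs' : φ =ᶠ[𝓝 s] fun r => a + b * r := hs
    rw [hs'.deriv_eq]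
    simp
  rw [h1.deriv_eq]
  simp

lemma polynomial_eq_of_eventually_eval_eq {P Q : ℝ[X]} {t : ℝ}
    (h : ∀ᶠ s in 𝓝 t, P.eval s = Q.eval s) : P = Q :=
  Polynomial.eq_of_infinite_eval_eq P Q (infinite_of_mem_nhds t h)

/-- A continuous function that is locally polynomial on an open interval is given by a single
polynomial on its closure. -/
lemma exists_polynomial_of_forall_Ioo {φ : ℝ → ℝ} {a b : ℝ} (hab : a < b)
    (hc : ContinuousOn φ (Set.Icc a b)) (h : ∀ t ∈ Set.Ioo a b, PolyAt φ t) :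
    ∃ P : ℝ[X], ∀ s ∈ Set.Icc a b, φ s = P.eval s := by
  have hm : (a + b) / 2 ∈ Set.Ioo a b := ⟨by linarith, by linarith⟩
  obtain ⟨P, hP⟩ := h _ hm
  refine ⟨P, ?_⟩
  -- Points where the germ is that of `P`, against points where it is that of another polynomial:
  -- two disjoint open sets covering a connected interval.
  let u : Set ℝ := {t | ∀ᶠ s in 𝓝 t, φ s = P.eval s}
  let v : Set ℝ := ⋃ Q ∈ {Q : ℝ[X] | Q ≠ P}, {t | ∀ᶠ s in 𝓝 t, φ s = Q.eval s}
  have hu : IsOpen u := isOpen_setOfPred_eventually_nhds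
  have hv : IsOpen v := isOpen_biUnion fun _ _ => isOpen_setOfPred_eventually_nhds
  have huv : Disjoint u v := by
    rw [Set.disjoint_left]
    intro t ht htv
    simp only [v, Set.mem_iUnion] at htv
    obtain ⟨Q, hQ, htQ⟩ := htv
    refine hQ (polynomial_eq_of_eventually_eval_eq (t := t) ?_)
    have ht' : ∀ᶠ s in 𝓝 t, φ s = P.eval s := ht
    have htQ' : ∀ᶠ s in 𝓝 t, φ s = Q.eval s := htQ
    filter_upwards [ht', htQ'] with s h1 h2
    rw [← h1, ← h2]
  have hsub : Set.Ioo a b ⊆ u ∪ v := by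
    intro t ht
    obtain ⟨Q, hQ⟩ := h t ht
    by_cases hQP : Q = P
    · left; subst hQP; exact hQ
    · right
      simp only [v, Set.mem_iUnion]
      exact ⟨Q, hQP, hQ⟩
  have hall := isPreconnected_Ioo.subset_left_of_subset_union hu hv huv hsub ⟨_, hm, hP⟩
  have heq : Set.EqOn φ (fun s => P.eval s) (Set.Ioo a b) := fun s hs =>
    (show ∀ᶠ s in 𝓝 s, φ s = P.eval s from hall hs).self_of_nhds
  exact heq.of_subset_closure hc P.continuous.continuousOn Set.Ioo_subset_Icc_self
    (by rw [closure_Ioo hab.ne])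

/-- A continuous function that is locally affine on an open interval is affine on its closure. -/
lemma exists_affine_of_forall_Ioo {φ : ℝ → ℝ} {a b : ℝ} (hab : a < b)
    (hc : ContinuousOn φ (Set.Icc a b)) (h : ∀ t ∈ Set.Ioo a b, AffineNear φ t) :
    ∃ c d : ℝ, ∀ s ∈ Set.Icc a b, φ s = c + d * s := by
  obtain ⟨P, hP⟩ := exists_polynomial_of_forall_Ioo hab hc fun t ht => (h t ht).polyAt
  have hm : (a + b) / 2 ∈ Set.Ioo a b := ⟨by linarith, by linarith⟩
  obtain ⟨c, d, hcd⟩ := h _ hm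
  have : P = C c + C d * X := by
    refine polynomial_eq_of_eventually_eval_eq (t := (a + b) / 2) ?_
    filter_upwards [hcd, Icc_mem_nhds hm.1 hm.2] with s h1 h2
    rw [← hP s h2, h1]; simp
  exact ⟨c, d, fun s hs => by rw [hP s hs, this]; simp⟩

/-- To prove an additive property of intervals, it suffices to treat those that contain no point of
a given finite set in their interior. -/
lemma interval_induction (T : Finset ℝ) (Q : ℝ → ℝ → Prop)
    (hgap : ∀ a b, a < b → (∀ t ∈ T, t ∉ Set.Ioo a b) → Q a b)
    (hadd : ∀ a c b, c ∈ T → a < c → c < b → Q a c → Q c b → Q a b) :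
    ∀ a b, a < b → Q a b := by
  classical
  -- Induction on the number of points of `T` in the interior; cutting at one of them lowers it on
  -- both sides.
  suffices H : ∀ n : ℕ, ∀ a b, a < b → (T.filter (· ∈ Set.Ioo a b)).card ≤ n → Q a b from
    fun a b hab => H _ a b hab le_rfl
  intro n
  induction n with
  | zero =>
    intro a b hab h
    refine hgap a b hab fun t ht htab => ?_
    have : t ∈ T.filter (· ∈ Set.Ioo a b) := Finset.mem_filter.2 ⟨ht, htab⟩
    rw [Nat.le_zero, Finset.card_eq_zero] at h
    rw [h] at this
    simp at this
  | succ n ih =>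
    intro a b hab h
    by_cases hex : ∃ c ∈ T, c ∈ Set.Ioo a b
    · obtain ⟨c, hc, hca, hcb⟩ := hex
      have hlt : ∀ a' b', a ≤ a' → b' ≤ b → c ∉ Set.Ioo a' b' →
          (T.filter (· ∈ Set.Ioo a' b')).card ≤ n := by
        intro a' b' ha hb hcn
        refine Nat.le_of_lt_succ (lt_of_lt_of_le (Finset.card_lt_card ?_) h)
        refine (Finset.ssubset_iff_of_subset fun t ht => ?_).2 ⟨c, ?_, ?_⟩
        · simp only [Finset.mem_filter, Set.mem_Ioo] at ht ⊢
          exact ⟨ht.1, by linarith [ht.2.1], by linarith [ht.2.2]⟩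
        · exact Finset.mem_filter.2 ⟨hc, hca, hcb⟩
        · exact fun h => hcn (Finset.mem_filter.1 h).2
      exact hadd a c b hc hca hcb
        (ih a c hca (hlt a c le_rfl hcb.le fun h => lt_irrefl _ h.2))
        (ih c b hcb (hlt c b hca.le le_rfl fun h => lt_irrefl _ h.1))
    · exact hgap a b hab fun t ht htab => hex ⟨t, ht, htab⟩

/-- A continuous function that is locally polynomial on the interval `(a, b)` off the finite
set `T`. -/
structure PiecewisePoly (T : Finset ℝ) (a b : ℝ) (φ : ℝ → ℝ) : Prop where
  cont : Continuous φ
  poly : ∀ t ∈ Set.Ioo a b, t ∉ T → PolyAt φ t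

namespace PiecewisePoly

variable {T : Finset ℝ} {a b : ℝ} {φ ψ χ : ℝ → ℝ}

lemma mono (h : PiecewisePoly T a b φ) {a' b' : ℝ} (ha : a ≤ a') (hb : b' ≤ b) :
    PiecewisePoly T a' b' φ :=
  ⟨h.cont, fun t ht => h.poly t ⟨ha.trans_lt ht.1, ht.2.trans_le hb⟩⟩

lemma exists_polynomial (h : PiecewisePoly T a b φ) (hab : a < b)
    (hgap : ∀ t ∈ T, t ∉ Set.Ioo a b) : ∃ P : ℝ[X], ∀ s ∈ Set.Icc a b, φ s = P.eval s :=
  exists_polynomial_of_forall_Ioo hab h.cont.continuousOn fun t ht =>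
    h.poly t ht fun hT => hgap t hT ht

end PiecewisePoly

variable {a b : ℝ} {φ : ℝ → ℝ} {P : ℝ[X]}

lemma deriv_eq_of_eqOn_polynomial (h : ∀ s ∈ Set.Icc a b, φ s = P.eval s) {t : ℝ}
    (ht : t ∈ Set.Ioo a b) : deriv φ t = P.derivative.eval t := by
  have : φ =ᶠ[𝓝 t] fun s => P.eval s := by
    filter_upwards [Icc_mem_nhds ht.1 ht.2] with s hs using h s hs
  rw [this.deriv_eq, Polynomial.deriv]

lemma deriv_deriv_eq_of_eqOn_polynomial (h : ∀ s ∈ Set.Icc a b, φ s = P.eval s) {t : ℝ}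
    (ht : t ∈ Set.Ioo a b) : deriv (deriv φ) t = P.derivative.derivative.eval t := by
  have : deriv φ =ᶠ[𝓝 t] fun s => P.derivative.eval s := by
    filter_upwards [Ioo_mem_nhds ht.1 ht.2] with s hs using deriv_eq_of_eqOn_polynomial h hs
  rw [this.deriv_eq, Polynomial.deriv]

lemma hasDerivWithinAt_Ici_of_eqOn_polynomial (hab : a < b)
    (h : ∀ s ∈ Set.Icc a b, φ s = P.eval s) :
    HasDerivWithinAt φ (P.derivative.eval a) (Set.Ici a) a := by
  refine (P.hasDerivAt a).hasDerivWithinAt.congr_of_eventuallyEq ?_ (h a ⟨le_rfl, hab.le⟩)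
  filter_upwards [Icc_mem_nhdsGE hab] with s hs using h s hs

lemma hasDerivWithinAt_Iic_of_eqOn_polynomial (hab : a < b)
    (h : ∀ s ∈ Set.Icc a b, φ s = P.eval s) :
    HasDerivWithinAt φ (P.derivative.eval b) (Set.Iic b) b := by
  refine (P.hasDerivAt b).hasDerivWithinAt.congr_of_eventuallyEq ?_ (h b ⟨hab.le, le_rfl⟩)
  filter_upwards [Icc_mem_nhdsLE hab] with s hs using h s hs

lemma derivWithin_Ici_of_eqOn_polynomial (hab : a < b)
    (h : ∀ s ∈ Set.Icc a b, φ s = P.eval s) :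
    derivWithin φ (Set.Ici a) a = P.derivative.eval a :=
  (hasDerivWithinAt_Ici_of_eqOn_polynomial hab h).derivWithin (uniqueDiffWithinAt_Ici a)

lemma derivWithin_Iic_of_eqOn_polynomial (hab : a < b)
    (h : ∀ s ∈ Set.Icc a b, φ s = P.eval s) :
    derivWithin φ (Set.Iic b) b = P.derivative.eval b :=
  (hasDerivWithinAt_Iic_of_eqOn_polynomial hab h).derivWithin (uniqueDiffWithinAt_Iic b)

namespace PiecewisePoly

variable {T : Finset ℝ} {ψ χ : ℝ → ℝ}

/-- Between consecutive breaks the derivatives agree with polynomials on the open interval; the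
value of `deriv` at a break is immaterial. -/
lemma intervalIntegrable_mul_deriv_mul_deriv (hab : a < b) (hχ : PiecewisePoly T a b χ)
    (hφ : PiecewisePoly T a b φ) (hψ : PiecewisePoly T a b ψ) :
    IntervalIntegrable (fun t => χ t * deriv φ t * deriv ψ t) volume a b := by
  suffices H : ∀ c d, c < d → a ≤ c → d ≤ b →
      IntervalIntegrable (fun t => χ t * deriv φ t * deriv ψ t) volume c d from
    H a b hab le_rfl le_rfl
  refine interval_induction T _ (fun c d hcd hgap hc hd => ?_)
    fun c m d _ hcm hmd h1 h2 hc hd =>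
      (h1 hc (hmd.le.trans hd)).trans (h2 (hc.trans hcm.le) hd)
  obtain ⟨P, hP⟩ := (hφ.mono hc hd).exists_polynomial hcd hgap
  obtain ⟨Q, hQ⟩ := (hψ.mono hc hd).exists_polynomial hcd hgap
  refine (intervalIntegrable_congr_uIoo (g := fun t => χ t * P.derivative.eval t *
    Q.derivative.eval t) fun t ht => ?_).2 (Continuous.intervalIntegrable ?_ _ _)
  · rw [Set.uIoo_of_le hcd.le] at ht
    simp only
    rw [deriv_eq_of_eqOn_polynomial hP ht, deriv_eq_of_eqOn_polynomial hQ ht]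
  · exact (hχ.cont.mul P.derivative.continuous).mul Q.derivative.continuous

lemma intervalIntegrable_deriv_deriv_mul (hab : a < b) (hφ : PiecewisePoly T a b φ)
    (hψ : Continuous ψ) :
    IntervalIntegrable (fun t => deriv (deriv φ) t * ψ t) volume a b := by
  suffices H : ∀ c d, c < d → a ≤ c → d ≤ b →
      IntervalIntegrable (fun t => deriv (deriv φ) t * ψ t) volume c d from
    H a b hab le_rfl le_rfl
  refine interval_induction T _ (fun c d hcd hgap hc hd => ?_)
    fun c m d _ hcm hmd h1 h2 hc hd =>
      (h1 hc (hmd.le.trans hd)).trans (h2 (hc.trans hcm.le) hd)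
  obtain ⟨P, hP⟩ := (hφ.mono hc hd).exists_polynomial hcd hgap
  refine (intervalIntegrable_congr_uIoo (g := fun t => P.derivative.derivative.eval t * ψ t)
    fun t ht => ?_).2 (Continuous.intervalIntegrable ?_ _ _)
  · rw [Set.uIoo_of_le hcd.le] at ht
    simp only
    rw [deriv_deriv_eq_of_eqOn_polynomial hP ht]
  · exact P.derivative.derivative.continuous.mul hψ

/-- Integration by parts for piecewise polynomial functions. -/
lemma integral_deriv_mul_deriv (hab : a < b) (ha : a ∈ T) (hb : b ∈ T)
    (hφ : PiecewisePoly T a b φ) (hψ : PiecewisePoly T a b ψ) :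
    (∫ t in a..b, deriv φ t * deriv ψ t) + ∫ t in a..b, deriv (deriv φ) t * ψ t =
      (∑ t ∈ T with t ∈ Set.Ioc a b, derivWithin φ (Set.Iic t) t * ψ t)
        - ∑ t ∈ T with t ∈ Set.Ico a b, derivWithin φ (Set.Ici t) t * ψ t := by
  suffices H : ∀ c d, c < d → a ≤ c → d ≤ b → c ∈ T → d ∈ T →
      (∫ t in c..d, deriv φ t * deriv ψ t) + ∫ t in c..d, deriv (deriv φ) t * ψ t =
      (∑ t ∈ T with t ∈ Set.Ioc c d, derivWithin φ (Set.Iic t) t * ψ t)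
        - ∑ t ∈ T with t ∈ Set.Ico c d, derivWithin φ (Set.Ici t) t * ψ t from
    H a b hab le_rfl le_rfl ha hb
  refine interval_induction T _ (fun c d hcd hgap hc hd hcT hdT => ?_)
    fun c m d hmT hcm hmd h1 h2 hc hd hcT hdT => ?_
  · have e1 : (T.filter (· ∈ Set.Ioc c d)) = {d} := by
      ext t
      simp only [Finset.mem_filter, Set.mem_Ioc, Finset.mem_singleton]
      refine ⟨fun ⟨h, h1, h2⟩ => ?_, by rintro rfl; exact ⟨hdT, hcd, le_rfl⟩⟩
      exact h2.eq_or_lt.resolve_right fun h3 => hgap t h ⟨h1, h3⟩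
    have e2 : (T.filter (· ∈ Set.Ico c d)) = {c} := by
      ext t
      simp only [Finset.mem_filter, Set.mem_Ico, Finset.mem_singleton]
      refine ⟨fun ⟨h, h1, h2⟩ => ?_, by rintro rfl; exact ⟨hcT, le_rfl, hcd⟩⟩
      exact (h1.eq_or_lt.resolve_right fun h3 => hgap t h ⟨h3, h2⟩).symm
    obtain ⟨P, hP⟩ := (hφ.mono hc hd).exists_polynomial hcd hgap
    obtain ⟨Q, hQ⟩ := (hψ.mono hc hd).exists_polynomial hcd hgap
    rw [e1, e2, Finset.sum_singleton, Finset.sum_singleton,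
      derivWithin_Iic_of_eqOn_polynomial hcd hP, derivWithin_Ici_of_eqOn_polynomial hcd hP,
      hQ c ⟨le_rfl, hcd.le⟩, hQ d ⟨hcd.le, le_rfl⟩]
    have I1 : ∫ t in c..d, deriv φ t * deriv ψ t =
        ∫ t in c..d, P.derivative.eval t * Q.derivative.eval t :=
      intervalIntegral.integral_congr_Ioo_of_le hcd.le fun t ht => by
        simp only [deriv_eq_of_eqOn_polynomial hP ht, deriv_eq_of_eqOn_polynomial hQ ht]
    have I2 : ∫ t in c..d, deriv (deriv φ) t * ψ t =
        ∫ t in c..d, P.derivative.derivative.eval t * Q.eval t :=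
      intervalIntegral.integral_congr_Ioo_of_le hcd.le fun t ht => by
        simp only [deriv_deriv_eq_of_eqOn_polynomial hP ht, hQ t (Set.Ioo_subset_Icc_self ht)]
    rw [I1, I2, ← intervalIntegral.integral_add
        (Continuous.intervalIntegrable (by fun_prop) _ _)
        (Continuous.intervalIntegrable (by fun_prop) _ _)]
    have hd : ∀ t, HasDerivAt (fun t => P.derivative.eval t * Q.eval t)
        (P.derivative.eval t * Q.derivative.eval t + P.derivative.derivative.eval t * Q.eval t)
        t := by
      intro t
      have := (P.derivative * Q).hasDerivAt t
      simp only [Polynomial.derivative_mul, Polynomial.eval_add, Polynomial.eval_mul] at this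
      rwa [add_comm] at this
    rw [intervalIntegral.integral_eq_sub_of_hasDerivAt (fun t _ => hd t)
      (Continuous.intervalIntegrable (by fun_prop) _ _)]
  · have hc' := hc.trans hcm.le
    have hd' := hmd.le.trans hd
    have i1 : ∀ x y, x < y → a ≤ x → y ≤ b →
        IntervalIntegrable (fun t => deriv φ t * deriv ψ t) volume x y := by
      intro x y hxy hx hy
      simpa using intervalIntegrable_mul_deriv_mul_deriv hxy
        (χ := fun _ => 1) ⟨continuous_const, fun t _ _ => polyAt_const 1 t⟩ (hφ.mono hx hy)
        (hψ.mono hx hy)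
    have i2 : ∀ x y, x < y → a ≤ x → y ≤ b →
        IntervalIntegrable (fun t => deriv (deriv φ) t * ψ t) volume x y :=
      fun x y hxy hx hy => intervalIntegrable_deriv_deriv_mul hxy (hφ.mono hx hy) hψ.cont
    -- At the cut `m` the left slope belongs to `(c, m]` and the right slope to `[m, d)`, so both
    -- half-open index sets split without overlap.
    have s1 : ∀ F : ℝ → ℝ, ∑ t ∈ T with t ∈ Set.Ioc c d, F t =
        ∑ t ∈ T with t ∈ Set.Ioc c m, F t + ∑ t ∈ T with t ∈ Set.Ioc m d, F t := by
      intro F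
      rw [← Finset.sum_union]
      · rw [← Finset.filter_or]
        congr 1
        ext t
        rw [Finset.mem_filter, Finset.mem_filter, ← Set.mem_union,
          Set.Ioc_union_Ioc_eq_Ioc hcm.le hmd.le]
      · rw [Finset.disjoint_filter]
        exact fun t _ h1 h2 => absurd h1.2 (not_le.2 h2.1)
    have s2 : ∀ F : ℝ → ℝ, ∑ t ∈ T with t ∈ Set.Ico c d, F t =
        ∑ t ∈ T with t ∈ Set.Ico c m, F t + ∑ t ∈ T with t ∈ Set.Ico m d, F t := by
      intro F
      rw [← Finset.sum_union]
      · rw [← Finset.filter_or]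
        congr 1
        ext t
        rw [Finset.mem_filter, Finset.mem_filter, ← Set.mem_union,
          Set.Ico_union_Ico_eq_Ico hcm.le hmd.le]
      · rw [Finset.disjoint_filter]
        exact fun t _ h1 h2 => absurd h1.2 (not_lt.2 h2.1)
    rw [s1, s2, ← intervalIntegral.integral_add_adjacent_intervals (i1 c m hcm hc hd')
        (i1 m d hmd hc' hd),
      ← intervalIntegral.integral_add_adjacent_intervals (i2 c m hcm hc hd') (i2 m d hmd hc' hd)]
    linarith [h1 hc hd' hcT hmT, h2 hc' hd hmT hdT]

/-- The derivative vanishes almost everywhere, and the fundamental theorem of calculus tolerates the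
finite exceptional set. -/
lemma eq_of_integral_deriv_mul_deriv_eq_zero (hab : a < b) (hφ : PiecewisePoly T a b φ)
    (h : ∫ t in a..b, deriv φ t * deriv φ t = 0) : ∀ s ∈ Set.Icc a b, φ s = φ a := by
  have hint : IntervalIntegrable (fun t => deriv φ t * deriv φ t) volume a b := by
    simpa using intervalIntegrable_mul_deriv_mul_deriv hab
        (χ := fun _ => 1) ⟨continuous_const, fun t _ _ => polyAt_const 1 t⟩ hφ hφ
  have hae : deriv φ =ᵐ[volume.restrict (Set.Ioc a b)] 0 := by
    have := (intervalIntegral.integral_eq_zero_iff_of_le_of_nonneg_ae hab.le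
      (Eventually.of_forall fun t => mul_self_nonneg (deriv φ t)) hint).1 h
    filter_upwards [this] with t ht
    exact mul_self_eq_zero.1 ht
  intro s hs
  have hae' : ∀ᵐ t, t ∈ Set.uIoc a s → deriv φ t = 0 := by
    rw [Set.uIoc_of_le hs.1, ← ae_restrict_iff' measurableSet_Ioc]
    exact ae_restrict_of_ae_restrict_of_subset (Set.Ioc_subset_Ioc_right hs.2) hae
  have h0 : ∫ t in a..s, deriv φ t = 0 := by
    rw [intervalIntegral.integral_congr_ae (g := fun _ => 0) hae']
    simp
  have hI : IntervalIntegrable (deriv φ) volume a s := by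
    refine (intervalIntegrable_congr_ae (g := fun _ => (0 : ℝ)) ?_).2 (by simp)
    exact (ae_restrict_iff' measurableSet_uIoc).2 hae'
  have := MeasureTheory.integral_eq_of_hasDerivAt_off_countable_of_le φ (deriv φ) hs.1
    T.countable_toSet hφ.cont.continuousOn
    (fun t ht => (hφ.poly t ⟨ht.1.1, ht.1.2.trans_le hs.2⟩ ht.2).differentiableAt.hasDerivAt) hI
  linarith

lemma integral_congr (hab : a ≤ b) {F G : ℝ → ℝ}
    (h : ∀ t ∈ Set.Ioo a b, t ∉ T → F t = G t) : ∫ t in a..b, F t = ∫ t in a..b, G t := by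
  refine intervalIntegral.integral_congr_ae ?_
  filter_upwards [(T.countable_toSet).ae_notMem volume,
    (Set.countable_singleton b).ae_notMem volume]
    with t h1 h2 ht
  rw [Set.uIoc_of_le hab] at ht
  exact h t ⟨ht.1, lt_of_le_of_ne ht.2 h2⟩ h1

end PiecewisePoly

/-- Piecewise linear interpolation. -/
lemma exists_piecewiseAffine_interpolation (T : Finset ℝ) (w : ℝ → ℝ) :
    ∃ φ : ℝ → ℝ, Continuous φ ∧ (∀ t ∈ T, φ t = w t) ∧ ∀ t ∉ T, AffineNear φ t := by
  induction T using Finset.induction_on_max with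
  | empty => exact ⟨fun _ => 0, continuous_const, by simp, fun t _ => affineNear_const 0 t⟩
  | insert m T hm ih =>
    obtain ⟨φ, hc, hφ, ha⟩ := ih
    rcases T.eq_empty_or_nonempty with rfl | hne
    · exact ⟨fun _ => w m, continuous_const, by simp, fun t _ => affineNear_const _ t⟩
    · set b := T.max' hne with hb
      have hbT : b ∈ T := T.max'_mem hne
      have hbm : b < m := hm b hbT
      -- A hinge that vanishes up to the last old node `b` keeps the old values; its slope is chosen
      -- to correct the value at `m`.
      refine ⟨fun s => φ s + (w m - φ m) / (m - b) * max 0 (s - b), by fun_prop, ?_, ?_⟩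
      · intro t ht
        rcases Finset.mem_insert.1 ht with rfl | ht
        · have h2 : t - b ≠ 0 := by linarith
          simp only
          rw [max_eq_right (by linarith)]
          field_simp
          ring
        · simp only
          rw [max_eq_left (by linarith [T.le_max' t ht]), hφ t ht]
          ring
      · intro t ht
        have htT : t ∉ T := fun h => ht (Finset.mem_insert_of_mem h)
        refine (ha t htT).add (AffineNear.const_mul _ ?_)
        rcases lt_trichotomy t b with h | h | h
        · refine ⟨0, 0, ?_⟩
          filter_upwards [Iio_mem_nhds h] with s hs
          rw [max_eq_left (by linarith [Set.mem_Iio.1 hs])]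
          ring
        · exact absurd (h ▸ hbT) htT
        · refine ⟨-b, 1, ?_⟩
          filter_upwards [Ioi_mem_nhds h] with s hs
          rw [max_eq_right (by linarith [Set.mem_Ioi.1 hs])]
          ring

end RealLine

end

noncomputable section

/-! ### One-sided differentiability at the breaks. -/

section RealLine

variable {T : Finset ℝ} {a b : ℝ} {φ : ℝ → ℝ}

lemma exists_gap_right (T : Finset ℝ) {t b : ℝ} (h : t < b) :
    ∃ d, t < d ∧ d ≤ b ∧ ∀ s ∈ T, s ∉ Set.Ioo t d := by
  classical
  have hmem : ((T.erase t : Finset ℝ) : Set ℝ)ᶜ ∈ 𝓝[>] t :=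
    mem_nhdsWithin_of_mem_nhds ((T.erase t).finite_toSet.isClosed.isOpen_compl.mem_nhds (by simp))
  obtain ⟨d, hd, hsub⟩ := (mem_nhdsGT_iff_exists_Ioo_subset' h).1 hmem
  refine ⟨min d b, lt_min hd h, min_le_right _ _, fun s hs hst => ?_⟩
  exact hsub ⟨hst.1, hst.2.trans_le (min_le_left _ _)⟩ (by simpa using ⟨hs, hst.1.ne'⟩)

lemma exists_gap_left (T : Finset ℝ) {t a : ℝ} (h : a < t) :
    ∃ c, c < t ∧ a ≤ c ∧ ∀ s ∈ T, s ∉ Set.Ioo c t := by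
  classical
  have hmem : ((T.erase t : Finset ℝ) : Set ℝ)ᶜ ∈ 𝓝[<] t :=
    mem_nhdsWithin_of_mem_nhds ((T.erase t).finite_toSet.isClosed.isOpen_compl.mem_nhds (by simp))
  obtain ⟨d, hd, hsub⟩ := (mem_nhdsLT_iff_exists_Ioo_subset' h).1 hmem
  refine ⟨max d a, max_lt hd h, le_max_right _ _, fun s hs hst => ?_⟩
  exact hsub ⟨(le_max_left _ _).trans_lt hst.1, hst.2⟩ (by simpa using ⟨hs, hst.2.ne⟩)

lemma PiecewisePoly.differentiableWithinAt_Ici (h : PiecewisePoly T a b φ) {t : ℝ}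
    (ht : t ∈ Set.Ico a b) : DifferentiableWithinAt ℝ φ (Set.Ici t) t := by
  obtain ⟨d, htd, hdb, hgap⟩ := exists_gap_right T ht.2
  obtain ⟨P, hP⟩ := (h.mono ht.1 hdb).exists_polynomial htd hgap
  exact (hasDerivWithinAt_Ici_of_eqOn_polynomial htd hP).differentiableWithinAt

lemma PiecewisePoly.differentiableWithinAt_Iic (h : PiecewisePoly T a b φ) {t : ℝ}
    (ht : t ∈ Set.Ioc a b) : DifferentiableWithinAt ℝ φ (Set.Iic t) t := by
  obtain ⟨d, htd, hdb, hgap⟩ := exists_gap_left T ht.1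
  obtain ⟨P, hP⟩ := (h.mono hdb ht.2).exists_polynomial htd hgap
  exact (hasDerivWithinAt_Iic_of_eqOn_polynomial htd hP).differentiableWithinAt

end RealLine

/-! ### Parameters, branch points and piecewise polynomial functions on a graph. -/

namespace MetrizedGraph

variable {Γ : MetrizedGraph.{u}}

lemma path_coe (e : Γ.Edge) (t : Set.Icc (0 : ℝ) (Γ.len e)) : Γ.path e t = Γ.proj ⟨e, t⟩ := by
  simp [path]

lemma path_of_mem {e : Γ.Edge} {t : ℝ} (ht : t ∈ Set.Icc 0 (Γ.len e)) :
    Γ.path e t = Γ.proj ⟨e, ⟨t, ht⟩⟩ := path_coe e ⟨t, ht⟩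

lemma continuous_path (e : Γ.Edge) : Continuous (Γ.path e) :=
  Γ.continuous_proj.comp (continuous_sigmaMk.comp continuous_projIcc)

lemma exists_path_eq (x : Γ.Point) : ∃ e, ∃ t ∈ Set.Icc 0 (Γ.len e), Γ.path e t = x := by
  obtain ⟨⟨e, t⟩, rfl⟩ := Γ.proj_surjective x
  exact ⟨e, t, t.2, path_coe e t⟩

lemma continuous_of_forall_path {Y : Type*} [TopologicalSpace Y] {f : Γ.Point → Y}
    (h : ∀ e, ContinuousOn (fun t => f (Γ.path e t)) (Set.Icc 0 (Γ.len e))) : Continuous f := by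
  refine continuous_coinduced_dom.2 (continuous_sigma fun e => ?_)
  have := (continuousOn_iff_continuous_domRestrict.1 (h e))
  refine this.congr fun t => ?_
  simp [path_coe]

instance : CompactSpace Γ.Point := by
  have : IsCompact (Set.range Γ.proj) := isCompact_range Γ.continuous_proj
  rw [Γ.proj_surjective.range_eq] at this
  exact ⟨this⟩

/-- The points that are ends of segments or at which gluing takes place. -/
def branchSet (Γ : MetrizedGraph.{u}) : Set Γ.Point :=
  (Set.range (fun e => Γ.path e 0) ∪ Set.range fun e => Γ.path e (Γ.len e)) ∪
    Γ.proj '' {a | ∃ b, b ≠ a ∧ Γ.proj b = Γ.proj a}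

lemma finite_branchSet (Γ : MetrizedGraph.{u}) : Γ.branchSet.Finite :=
  ((Set.finite_range _).union (Set.finite_range _)).union (Γ.finite_glued.image _)

/-- The finite set of ends of segments and points at which gluing takes place. -/
def branch (Γ : MetrizedGraph.{u}) : Finset Γ.Point := Γ.finite_branchSet.toFinset

lemma path_zero_mem_branch (e : Γ.Edge) : Γ.path e 0 ∈ Γ.branch := by
  simp [branch, branchSet]

lemma path_len_mem_branch (e : Γ.Edge) : Γ.path e (Γ.len e) ∈ Γ.branch := by
  simp [branch, branchSet]

/-- Every parameter that is glued to another one maps into `branch`, so a point off `branch` has a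
single parameter. -/
lemma eq_of_path_eq {e e' : Γ.Edge} {t t' : ℝ} (ht : t ∈ Set.Icc 0 (Γ.len e))
    (ht' : t' ∈ Set.Icc 0 (Γ.len e')) (h : Γ.path e' t' = Γ.path e t)
    (hb : Γ.path e t ∉ Γ.branch) : e' = e ∧ t' = t := by
  by_contra hne
  refine hb ?_
  rw [branch, Set.Finite.mem_toFinset, path_of_mem ht]
  refine Or.inr ⟨_, ⟨⟨e', ⟨t', ht'⟩⟩, ?_, ?_⟩, rfl⟩
  · intro heq
    apply hne
    cases heq
    exact ⟨rfl, rfl⟩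
  · rw [← path_of_mem, ← path_of_mem, h]

lemma mem_Ioo_of_path_notMem_branch {e : Γ.Edge} {t : ℝ} (ht : t ∈ Set.Icc 0 (Γ.len e))
    (hb : Γ.path e t ∉ Γ.branch) : t ∈ Set.Ioo 0 (Γ.len e) := by
  refine ⟨lt_of_le_of_ne ht.1 ?_, lt_of_le_of_ne ht.2 ?_⟩
  · rintro rfl; exact hb (path_zero_mem_branch e)
  · rintro rfl; exact hb (path_len_mem_branch e)

lemma finite_setOf_path_mem (V : Finset Γ.Point) (e : Γ.Edge) :
    {t | t ∈ Set.Icc 0 (Γ.len e) ∧ Γ.path e t ∈ V}.Finite := by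
  have h1 : (⋃ x ∈ V, {a | Γ.proj a = x}).Finite :=
    V.finite_toSet.biUnion fun x _ => Γ.finite_fiber x
  have h2 := h1.preimage (f := fun t : Set.Icc (0 : ℝ) (Γ.len e) =>
    (⟨e, t⟩ : Σ e, Set.Icc (0 : ℝ) (Γ.len e))) (fun s _ t _ h => by simpa using h)
  refine (h2.image Subtype.val).subset ?_
  rintro t ⟨ht, htV⟩
  refine ⟨⟨t, ht⟩, ?_, rfl⟩
  simpa [path_of_mem ht] using htV

/-- The parameters on the segment `e` of the points of `V`. -/
def breaks (V : Finset Γ.Point) (e : Γ.Edge) : Finset ℝ := (finite_setOf_path_mem V e).toFinset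

lemma mem_breaks {V : Finset Γ.Point} {e : Γ.Edge} {t : ℝ} :
    t ∈ breaks V e ↔ t ∈ Set.Icc 0 (Γ.len e) ∧ Γ.path e t ∈ V := by
  simp [breaks]

/-- A continuous function on a metrized graph that is locally polynomial in the parameters off
the finite set `V`. -/
structure PolyOff (V : Finset Γ.Point) (f : Γ.Point → ℝ) : Prop where
  cont : Continuous f
  poly : ∀ e, ∀ t ∈ Set.Ioo 0 (Γ.len e), Γ.path e t ∉ V → PolyAt (fun s => f (Γ.path e s)) t

/-- A continuous function on a metrized graph that is locally affine in the parameters off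
the finite set `V`. -/
structure AffineOff (V : Finset Γ.Point) (f : Γ.Point → ℝ) : Prop where
  cont : Continuous f
  affine : ∀ e, ∀ t ∈ Set.Ioo 0 (Γ.len e), Γ.path e t ∉ V →
    AffineNear (fun s => f (Γ.path e s)) t

/-- A continuous piecewise polynomial function on a metrized graph. -/
def IsPiecewisePoly (f : Γ.Point → ℝ) : Prop := ∃ V : Finset Γ.Point, PolyOff V f

lemma AffineOff.polyOff {V : Finset Γ.Point} {f : Γ.Point → ℝ} (h : AffineOff V f) :
    PolyOff V f := ⟨h.cont, fun e t ht hV => (h.affine e t ht hV).polyAt⟩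

lemma AffineOff.isPiecewisePoly {V : Finset Γ.Point} {f : Γ.Point → ℝ} (h : AffineOff V f) :
    IsPiecewisePoly f := ⟨V, h.polyOff⟩

lemma PolyOff.mono {V V' : Finset Γ.Point} {f : Γ.Point → ℝ} (h : PolyOff V f)
    (hV : V ⊆ V') : PolyOff V' f :=
  ⟨h.cont, fun e t ht hn => h.poly e t ht fun hm => hn (hV hm)⟩

lemma PolyOff.piecewisePoly {V : Finset Γ.Point} {f : Γ.Point → ℝ} (h : PolyOff V f)
    (e : Γ.Edge) : PiecewisePoly (breaks V e) 0 (Γ.len e) (fun s => f (Γ.path e s)) :=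
  ⟨h.cont.comp (continuous_path e), fun t ht hT => h.poly e t ht fun hV =>
    hT (mem_breaks.2 ⟨Set.Ioo_subset_Icc_self ht, hV⟩)⟩

section Algebra

open Classical in
lemma IsPiecewisePoly.exists_common {f g : Γ.Point → ℝ} (hf : IsPiecewisePoly f)
    (hg : IsPiecewisePoly g) : ∃ V, PolyOff V f ∧ PolyOff V g := by
  obtain ⟨V, hV⟩ := hf
  obtain ⟨V', hV'⟩ := hg
  exact ⟨V ∪ V', hV.mono Finset.subset_union_left, hV'.mono Finset.subset_union_right⟩

open Classical in
lemma IsPiecewisePoly.exists_common₃ {f g h : Γ.Point → ℝ} (hf : IsPiecewisePoly f)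
    (hg : IsPiecewisePoly g) (hh : IsPiecewisePoly h) :
    ∃ V, PolyOff V f ∧ PolyOff V g ∧ PolyOff V h := by
  obtain ⟨V, hV, hV'⟩ := hf.exists_common hg
  obtain ⟨V', hV''⟩ := hh
  exact ⟨V ∪ V', hV.mono Finset.subset_union_left, hV'.mono Finset.subset_union_left,
    hV''.mono Finset.subset_union_right⟩

lemma isPiecewisePoly_const (c : ℝ) : IsPiecewisePoly (fun _ : Γ.Point => c) :=
  ⟨∅, continuous_const, fun _ t _ _ => polyAt_const c t⟩

lemma IsPiecewisePoly.add {f g : Γ.Point → ℝ} (hf : IsPiecewisePoly f)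
    (hg : IsPiecewisePoly g) : IsPiecewisePoly (fun x => f x + g x) := by
  obtain ⟨V, hV, hV'⟩ := hf.exists_common hg
  exact ⟨V, hV.cont.add hV'.cont, fun e t ht hn => (hV.poly e t ht hn).add (hV'.poly e t ht hn)⟩

lemma IsPiecewisePoly.mul {f g : Γ.Point → ℝ} (hf : IsPiecewisePoly f)
    (hg : IsPiecewisePoly g) : IsPiecewisePoly (fun x => f x * g x) := by
  obtain ⟨V, hV, hV'⟩ := hf.exists_common hg
  exact ⟨V, hV.cont.mul hV'.cont, fun e t ht hn => (hV.poly e t ht hn).mul (hV'.poly e t ht hn)⟩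

lemma IsPiecewisePoly.const_mul {f : Γ.Point → ℝ} (c : ℝ) (hf : IsPiecewisePoly f) :
    IsPiecewisePoly (fun x => c * f x) := (isPiecewisePoly_const c).mul hf

lemma IsPiecewisePoly.sub {f g : Γ.Point → ℝ} (hf : IsPiecewisePoly f)
    (hg : IsPiecewisePoly g) : IsPiecewisePoly (fun x => f x - g x) := by
  have := hf.add (hg.const_mul (-1))
  simpa [sub_eq_add_neg] using this

lemma IsPiecewisePoly.continuous {f : Γ.Point → ℝ} (hf : IsPiecewisePoly f) : Continuous f :=
  hf.choose_spec.cont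

end Algebra

/-! ### The energy pairing. -/

/-- The weighted energy pairing `∫ h f' g' dx`. -/
def energy (h f g : Γ.Point → ℝ) : ℝ :=
  ∑ e, ∫ t in (0 : ℝ)..Γ.len e,
    h (Γ.path e t) * deriv (fun s => f (Γ.path e s)) t * deriv (fun s => g (Γ.path e s)) t

section Energy

variable {h h' f f' g g' : Γ.Point → ℝ}

lemma energy_comm (h f g : Γ.Point → ℝ) : energy h f g = energy h g f := by
  unfold energy
  refine Finset.sum_congr rfl fun e _ => intervalIntegral.integral_congr fun t _ => ?_
  ring

lemma PolyOff.intervalIntegrable {V : Finset Γ.Point} (hh : PolyOff V h) (hf : PolyOff V f)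
    (hg : PolyOff V g) (e : Γ.Edge) :
    IntervalIntegrable (fun t => h (Γ.path e t) * deriv (fun s => f (Γ.path e s)) t *
      deriv (fun s => g (Γ.path e s)) t) volume 0 (Γ.len e) :=
  PiecewisePoly.intervalIntegrable_mul_deriv_mul_deriv (Γ.len_pos e) (hh.piecewisePoly e)
    (hf.piecewisePoly e) (hg.piecewisePoly e)

lemma PolyOff.differentiableAt {V : Finset Γ.Point} (hf : PolyOff V f) {e : Γ.Edge} {t : ℝ}
    (ht : t ∈ Set.Ioo 0 (Γ.len e)) (hV : t ∉ breaks V e) :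
    DifferentiableAt ℝ (fun s => f (Γ.path e s)) t :=
  ((hf.piecewisePoly e).poly t ht hV).differentiableAt

lemma energy_add_left (hh : IsPiecewisePoly h) (hh' : IsPiecewisePoly h')
    (hf : IsPiecewisePoly f) (hg : IsPiecewisePoly g) :
    energy (fun x => h x + h' x) f g = energy h f g + energy h' f g := by
  obtain ⟨V, hV, hVf, hVg⟩ := hh.exists_common₃ hf hg
  obtain ⟨V', hV', hVf', hVg'⟩ := hh'.exists_common₃ hf hg
  unfold energy
  rw [← Finset.sum_add_distrib]
  refine Finset.sum_congr rfl fun e _ => ?_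
  rw [← intervalIntegral.integral_add (hV.intervalIntegrable hVf hVg e)
    (hV'.intervalIntegrable hVf' hVg' e)]
  refine intervalIntegral.integral_congr fun t _ => ?_
  simp only
  ring

lemma energy_const_mul_left (c : ℝ) (h f g : Γ.Point → ℝ) :
    energy (fun x => c * h x) f g = c * energy h f g := by
  unfold energy
  rw [Finset.mul_sum]
  refine Finset.sum_congr rfl fun e _ => ?_
  rw [← intervalIntegral.integral_const_mul]
  refine intervalIntegral.integral_congr fun t _ => ?_
  simp only
  ring

/-- The Leibniz rule for the energy pairing. -/
lemma energy_mul (hh : IsPiecewisePoly h) (hf : IsPiecewisePoly f) (hf' : IsPiecewisePoly f')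
    (hg : IsPiecewisePoly g) :
    energy h (fun x => f x * f' x) g =
      energy (fun x => h x * f' x) f g + energy (fun x => h x * f x) f' g := by
  obtain ⟨V, hVf, hVf', hVg⟩ := hf.exists_common₃ hf' hg
  obtain ⟨V₁, h₁, h₂, h₃⟩ := (hh.mul hf').exists_common₃ hf hg
  obtain ⟨V₂, h₁', h₂', h₃'⟩ := (hh.mul hf).exists_common₃ hf' hg
  unfold energy
  rw [← Finset.sum_add_distrib]
  refine Finset.sum_congr rfl fun e _ => ?_
  rw [← intervalIntegral.integral_add (h₁.intervalIntegrable h₂ h₃ e)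
    (h₁'.intervalIntegrable h₂' h₃' e)]
  refine PiecewisePoly.integral_congr (T := breaks V e) (Γ.len_pos e).le fun t ht hT => ?_
  rw [deriv_fun_mul (hVf.differentiableAt ht hT) (hVf'.differentiableAt ht hT)]
  ring

lemma energy_add_right (hh : IsPiecewisePoly h) (hf : IsPiecewisePoly f) (hg : IsPiecewisePoly g)
    (hg' : IsPiecewisePoly g') :
    energy h f (fun x => g x + g' x) = energy h f g + energy h f g' := by
  obtain ⟨V, hVh, hVf, hVg⟩ := hh.exists_common₃ hf hg
  obtain ⟨V', hVh', hVf', hVg'⟩ := hh.exists_common₃ hf hg'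
  obtain ⟨V'', h₁, h₂⟩ := hg.exists_common hg'
  unfold energy
  rw [← Finset.sum_add_distrib]
  refine Finset.sum_congr rfl fun e _ => ?_
  rw [← intervalIntegral.integral_add (hVh.intervalIntegrable hVf hVg e)
    (hVh'.intervalIntegrable hVf' hVg' e)]
  refine PiecewisePoly.integral_congr (T := breaks V'' e) (Γ.len_pos e).le fun t ht hT => ?_
  rw [deriv_fun_add (h₁.differentiableAt ht hT) (h₂.differentiableAt ht hT)]
  ring

lemma energy_const_mul_right (c : ℝ) (h f g : Γ.Point → ℝ) :
    energy h f (fun x => c * g x) = c * energy h f g := by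
  unfold energy
  rw [Finset.mul_sum]
  refine Finset.sum_congr rfl fun e _ => ?_
  rw [← intervalIntegral.integral_const_mul]
  refine intervalIntegral.integral_congr fun t _ => ?_
  simp only [deriv_const_mul_field]
  ring

lemma energy_const_right (c : ℝ) (h f : Γ.Point → ℝ) : energy h f (fun _ => c) = 0 := by
  simp [energy]

lemma energy_sub_right (hh : IsPiecewisePoly h) (hf : IsPiecewisePoly f) (hg : IsPiecewisePoly g)
    (hg' : IsPiecewisePoly g') :
    energy h f (fun x => g x - g' x) = energy h f g - energy h f g' := by
  have := energy_add_right hh hf hg (hg'.const_mul (-1))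
  rw [energy_const_mul_right] at this
  simpa [sub_eq_add_neg] using this

lemma energy_self_nonneg (f : Γ.Point → ℝ) : 0 ≤ energy (fun _ => 1) f f := by
  refine Finset.sum_nonneg fun e _ =>
    intervalIntegral.integral_nonneg (Γ.len_pos e).le fun t _ => ?_
  rw [one_mul]
  exact mul_self_nonneg _

/-- Zero energy makes `f` constant on each segment, hence finitely valued; a connected finite set of
reals has at most one element. -/
lemma eq_of_energy_self_eq_zero (hf : IsPiecewisePoly f) (h0 : energy (fun _ => 1) f f = 0)
    (x y : Γ.Point) : f x = f y := by
  obtain ⟨V, hV⟩ := hf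
  have h1 := (Finset.sum_eq_zero_iff_of_nonneg fun e _ =>
    intervalIntegral.integral_nonneg (Γ.len_pos e).le fun t _ => by
      rw [one_mul]; exact mul_self_nonneg _).1 h0
  have hedge : ∀ e, ∀ t ∈ Set.Icc 0 (Γ.len e), f (Γ.path e t) = f (Γ.path e 0) := fun e =>
    (hV.piecewisePoly e).eq_of_integral_deriv_mul_deriv_eq_zero (Γ.len_pos e)
      (by simpa using h1 e (Finset.mem_univ e))
  have hfin : (Set.range f).Finite := by
    refine (Set.finite_range fun e => f (Γ.path e 0)).subset ?_
    rintro _ ⟨x, rfl⟩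
    obtain ⟨e, t, ht, rfl⟩ := exists_path_eq x
    exact ⟨e, (hedge e t ht).symm⟩
  have hsub : (Set.range f).Subsingleton := by
    by_contra hns
    exact (isPreconnected_range hV.cont).infinite_of_nontrivial
      (Set.not_subsingleton_iff.1 hns) hfin
  exact hsub ⟨x, rfl⟩ ⟨y, rfl⟩

end Energy

/-! ### Green's identity and slope sums. -/

section Green

variable {V : Finset Γ.Point} {f g : Γ.Point → ℝ}

-- Fibres are finite, so the `finsum`s in `slopeSum` are genuine sums and not the default value 0.
open Classical in
lemma slopeSum_eq_sum_breaks {x : Γ.Point} (hx : x ∈ V) (f : Γ.Point → ℝ) :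
    Γ.slopeSum f x = ∑ e,
      ((∑ t ∈ (breaks V e).filter (· ∈ Set.Ico 0 (Γ.len e)) with Γ.path e t = x,
          derivWithin (fun s => f (Γ.path e s)) (Set.Ici t) t)
        + ∑ t ∈ (breaks V e).filter (· ∈ Set.Ioc 0 (Γ.len e)) with Γ.path e t = x,
          -derivWithin (fun s => f (Γ.path e s)) (Set.Iic t) t) := by
  unfold slopeSum
  refine Finset.sum_congr rfl fun e _ => ?_
  have h1 : {t | t ∈ Set.Ico 0 (Γ.len e) ∧ Γ.path e t = x} =
      ↑(((breaks V e).filter (· ∈ Set.Ico 0 (Γ.len e))).filter (Γ.path e · = x)) := by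
    ext t
    simp only [Finset.coe_filter, Set.mem_ofPred_eq, Finset.mem_filter, mem_breaks]
    exact ⟨fun h => ⟨⟨⟨Set.Ico_subset_Icc_self h.1, h.2 ▸ hx⟩, h.1⟩, h.2⟩, fun h => ⟨h.1.2, h.2⟩⟩
  have h2 : {t | t ∈ Set.Ioc 0 (Γ.len e) ∧ Γ.path e t = x} =
      ↑(((breaks V e).filter (· ∈ Set.Ioc 0 (Γ.len e))).filter (Γ.path e · = x)) := by
    ext t
    simp only [Finset.coe_filter, Set.mem_ofPred_eq, Finset.mem_filter, mem_breaks]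
    exact ⟨fun h => ⟨⟨⟨Set.Ioc_subset_Icc_self h.1, h.2 ▸ hx⟩, h.1⟩, h.2⟩, fun h => ⟨h.1.2, h.2⟩⟩
  rw [h1, h2, finsum_mem_coe_finset, finsum_mem_coe_finset]

/-- Green's identity on a metrized graph. -/
lemma energy_add_integral_eq_neg_sum_slopeSum (hV : Γ.branch ⊆ V) (hf : PolyOff V f)
    (hg : PolyOff V g) :
    energy (fun _ => 1) f g + ∑ e, ∫ t in (0 : ℝ)..Γ.len e,
        deriv (deriv fun s => f (Γ.path e s)) t * g (Γ.path e t) =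
      -∑ x ∈ V, Γ.slopeSum f x * g x := by
  classical
  -- The breaks on `e` are grouped by their image in `V`: the slopes at all points of `V` become
  -- slopes at all breaks of all segments.
  have hsum : ∑ x ∈ V, Γ.slopeSum f x * g x = ∑ e,
      ((∑ t ∈ breaks V e with t ∈ Set.Ico 0 (Γ.len e),
          derivWithin (fun s => f (Γ.path e s)) (Set.Ici t) t * g (Γ.path e t))
        + ∑ t ∈ breaks V e with t ∈ Set.Ioc 0 (Γ.len e),
          -derivWithin (fun s => f (Γ.path e s)) (Set.Iic t) t * g (Γ.path e t)) := by
    have h1 : ∀ x ∈ V, Γ.slopeSum f x * g x = ∑ e,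
      ((∑ t ∈ (breaks V e).filter (· ∈ Set.Ico 0 (Γ.len e)) with Γ.path e t = x,
          derivWithin (fun s => f (Γ.path e s)) (Set.Ici t) t * g (Γ.path e t))
        + ∑ t ∈ (breaks V e).filter (· ∈ Set.Ioc 0 (Γ.len e)) with Γ.path e t = x,
          -derivWithin (fun s => f (Γ.path e s)) (Set.Iic t) t * g (Γ.path e t)) := by
      intro x hx
      rw [slopeSum_eq_sum_breaks hx, Finset.sum_mul]
      refine Finset.sum_congr rfl fun e _ => ?_
      rw [add_mul, Finset.sum_mul, Finset.sum_mul]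
      congr 1 <;> refine Finset.sum_congr rfl fun t ht => ?_ <;>
        rw [(Finset.mem_filter.1 ht).2]
    rw [Finset.sum_congr rfl h1, Finset.sum_comm]
    refine Finset.sum_congr rfl fun e _ => ?_
    rw [Finset.sum_add_distrib]
    congr 1 <;> refine Finset.sum_fiberwise_of_maps_to (fun t ht => ?_) _ <;>
      exact (mem_breaks.1 (Finset.mem_filter.1 ht).1).2
  rw [hsum]
  unfold energy
  rw [← Finset.sum_add_distrib, ← Finset.sum_neg_distrib]
  refine Finset.sum_congr rfl fun e _ => ?_
  have := PiecewisePoly.integral_deriv_mul_deriv (Γ.len_pos e)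
    (mem_breaks.2 ⟨⟨le_rfl, (Γ.len_pos e).le⟩, hV (path_zero_mem_branch e)⟩)
    (mem_breaks.2 ⟨⟨(Γ.len_pos e).le, le_rfl⟩, hV (path_len_mem_branch e)⟩)
    (hf.piecewisePoly e) (hg.piecewisePoly e)
  simp only [one_mul, neg_mul, Finset.sum_neg_distrib]
  linarith

/-- The second derivative vanishes off the breaks, so only the point terms of Green's identity
remain. -/
lemma AffineOff.energy_eq (hV : Γ.branch ⊆ V) (hf : AffineOff V f) (hg : PolyOff V g) :
    energy (fun _ => 1) f g = -∑ x ∈ V, Γ.slopeSum f x * g x := by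
  rw [← energy_add_integral_eq_neg_sum_slopeSum hV hf.polyOff hg]
  rw [Finset.sum_eq_zero, add_zero]
  intro e _
  rw [PiecewisePoly.integral_congr (T := breaks V e) (G := fun _ => 0) (Γ.len_pos e).le]
  · simp
  · intro t ht hT
    rw [AffineNear.deriv_deriv, zero_mul]
    exact hf.affine e t ht fun h => hT (mem_breaks.2 ⟨Set.Ioo_subset_Icc_self ht, h⟩)

/-- The slopes at a point that is neither an end nor a gluing point. -/
lemma slopeSum_path {e : Γ.Edge} {t : ℝ} (ht : t ∈ Set.Icc 0 (Γ.len e))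
    (hb : Γ.path e t ∉ Γ.branch) (f : Γ.Point → ℝ) :
    Γ.slopeSum f (Γ.path e t) = derivWithin (fun s => f (Γ.path e s)) (Set.Ici t) t -
      derivWithin (fun s => f (Γ.path e s)) (Set.Iic t) t := by
  have ht' := mem_Ioo_of_path_notMem_branch ht hb
  unfold slopeSum
  rw [Finset.sum_eq_single e]
  · have h1 : {s | s ∈ Set.Ico 0 (Γ.len e) ∧ Γ.path e s = Γ.path e t} = {t} := by
      ext s
      simp only [Set.mem_ofPred_eq, Set.mem_singleton_iff]
      refine ⟨fun h => (eq_of_path_eq ht (Set.Ico_subset_Icc_self h.1) h.2 hb).2, ?_⟩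
      rintro rfl; exact ⟨Set.Ioo_subset_Ico_self ht', rfl⟩
    have h2 : {s | s ∈ Set.Ioc 0 (Γ.len e) ∧ Γ.path e s = Γ.path e t} = {t} := by
      ext s
      simp only [Set.mem_ofPred_eq, Set.mem_singleton_iff]
      refine ⟨fun h => (eq_of_path_eq ht (Set.Ioc_subset_Icc_self h.1) h.2 hb).2, ?_⟩
      rintro rfl; exact ⟨Set.Ioo_subset_Ioc_self ht', rfl⟩
    rw [h1, h2, finsum_mem_singleton, finsum_mem_singleton, sub_eq_add_neg]
  · intro e' _ hne
    have h1 : {s | s ∈ Set.Ico 0 (Γ.len e') ∧ Γ.path e' s = Γ.path e t} = ∅ := by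
      refine Set.eq_empty_of_forall_notMem fun s h => hne ?_
      exact (eq_of_path_eq ht (Set.Ico_subset_Icc_self h.1) h.2 hb).1
    have h2 : {s | s ∈ Set.Ioc 0 (Γ.len e') ∧ Γ.path e' s = Γ.path e t} = ∅ := by
      refine Set.eq_empty_of_forall_notMem fun s h => hne ?_
      exact (eq_of_path_eq ht (Set.Ioc_subset_Icc_self h.1) h.2 hb).1
    rw [h1, h2, finsum_mem_empty, finsum_mem_empty, add_zero]
  · simp

lemma PolyOff.slopeSum_eq_zero (hV : Γ.branch ⊆ V) (hf : PolyOff V f) {x : Γ.Point}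
    (hx : x ∉ V) : Γ.slopeSum f x = 0 := by
  obtain ⟨e, t, ht, rfl⟩ := exists_path_eq x
  have hb : Γ.path e t ∉ Γ.branch := fun h => hx (hV h)
  have hd := (hf.poly e t (mem_Ioo_of_path_notMem_branch ht hb) hx).differentiableAt
  rw [slopeSum_path ht hb, hd.derivWithin (uniqueDiffWithinAt_Ici t),
    hd.derivWithin (uniqueDiffWithinAt_Iic t), sub_self]

lemma PolyOff.slopeSum_add (hf : PolyOff V f) (hg : PolyOff V g) (x : Γ.Point) :
    Γ.slopeSum (fun y => f y + g y) x = Γ.slopeSum f x + Γ.slopeSum g x := by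
  classical
  rw [slopeSum_eq_sum_breaks (Finset.mem_singleton_self x),
    slopeSum_eq_sum_breaks (Finset.mem_singleton_self x),
    slopeSum_eq_sum_breaks (Finset.mem_singleton_self x), ← Finset.sum_add_distrib]
  refine Finset.sum_congr rfl fun e _ => ?_
  rw [add_add_add_comm, ← Finset.sum_add_distrib, ← Finset.sum_add_distrib]
  congr 1 <;> refine Finset.sum_congr rfl fun t ht => ?_ <;>
    simp only [Finset.mem_filter] at ht
  · exact derivWithin_fun_add ((hf.piecewisePoly e).differentiableWithinAt_Ici ht.1.2)
      ((hg.piecewisePoly e).differentiableWithinAt_Ici ht.1.2)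
  · rw [derivWithin_fun_add ((hf.piecewisePoly e).differentiableWithinAt_Iic ht.1.2)
      ((hg.piecewisePoly e).differentiableWithinAt_Iic ht.1.2)]
    ring

lemma slopeSum_const_mul (c : ℝ) (f : Γ.Point → ℝ) (x : Γ.Point) :
    Γ.slopeSum (fun y => c * f y) x = c * Γ.slopeSum f x := by
  classical
  rw [slopeSum_eq_sum_breaks (Finset.mem_singleton_self x),
    slopeSum_eq_sum_breaks (Finset.mem_singleton_self x), Finset.mul_sum]
  refine Finset.sum_congr rfl fun e _ => ?_
  rw [mul_add, Finset.mul_sum, Finset.mul_sum]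
  congr 1 <;> refine Finset.sum_congr rfl fun t _ => ?_
  · rw [derivWithin_const_mul_field]
  · rw [derivWithin_const_mul_field]
    ring

end Green

end MetrizedGraph

end

noncomputable section

namespace MetrizedGraph

variable {Γ : MetrizedGraph.{u}}

/-! ### Existence of voltage functions by linear algebra. -/

section Existence

variable {V : Finset Γ.Point}

/-- Piecewise linear interpolation on a metrized graph. -/
lemma exists_affineOff_eq (hV : Γ.branch ⊆ V) (w : Γ.Point → ℝ) :
    ∃ f, AffineOff V f ∧ ∀ x ∈ V, f x = w x := by
  choose φ hc hφ ha using fun e =>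
    exists_piecewiseAffine_interpolation (breaks V e) fun t => w (Γ.path e t)
  choose E τ hτ hE using exists_path_eq (Γ := Γ)
  let f : Γ.Point → ℝ := fun x => φ (E x) (τ x)
  have hfV : ∀ x ∈ V, f x = w x := by
    intro x hx
    have := hφ (E x) (τ x) (mem_breaks.2 ⟨hτ x, by rwa [hE x]⟩)
    rw [hE x] at this
    exact this
  have hf : ∀ e, ∀ t ∈ Set.Icc 0 (Γ.len e), f (Γ.path e t) = φ e t := by
    intro e t ht
    -- Independence of the chosen parameter: on `V` every parameter carries the value of `w`, and
    -- off `V` the parameter is unique.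
    by_cases hx : Γ.path e t ∈ V
    · rw [hfV _ hx, hφ e t (mem_breaks.2 ⟨ht, hx⟩)]
    · obtain ⟨h1, h2⟩ := eq_of_path_eq ht (hτ (Γ.path e t)) (hE _) fun h => hx (hV h)
      simp only [f]
      rw [h2, h1]
  refine ⟨f, ⟨continuous_of_forall_path fun e => ?_, fun e t ht hn => ?_⟩, hfV⟩
  · exact (hc e).continuousOn.congr fun t ht => hf e t ht
  · obtain ⟨a, b, hab⟩ := ha e t fun h => hn (mem_breaks.1 h).2
    refine ⟨a, b, ?_⟩
    filter_upwards [hab, Icc_mem_nhds ht.1 ht.2] with s h1 h2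
    rw [hf e s h2, h1]

/-- The space of continuous functions that are locally affine off `V`. -/
def affineOffSubmodule (V : Finset Γ.Point) : Submodule ℝ (Γ.Point → ℝ) where
  carrier := {f | AffineOff V f}
  add_mem' hf hg := ⟨hf.cont.add hg.cont, fun e t ht hn =>
    (hf.affine e t ht hn).add (hg.affine e t ht hn)⟩
  zero_mem' := ⟨continuous_const, fun _ t _ _ => affineNear_const 0 t⟩
  smul_mem' c _ hf := ⟨continuous_const.mul hf.cont, fun e t ht hn =>
    (hf.affine e t ht hn).const_mul c⟩

lemma AffineOff.sum_slopeSum (hV : Γ.branch ⊆ V) {f : Γ.Point → ℝ} (hf : AffineOff V f) :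
    ∑ x ∈ V, Γ.slopeSum f x = 0 := by
  have h := hf.energy_eq hV (g := fun _ => 1)
    ⟨continuous_const, fun _ t _ _ => polyAt_const 1 t⟩
  rw [energy_const_right] at h
  simpa using h.symm

open Classical in
/-- The linear map `f ↦ slopeSum f + f z δ_z`. -/
def slopeMap (V : Finset Γ.Point) (z : Γ.Point) : affineOffSubmodule V →ₗ[ℝ] (V → ℝ) where
  toFun f x := Γ.slopeSum f.1 x + if x.1 = z then f.1 z else 0
  map_add' f g := by
    ext x
    have := PolyOff.slopeSum_add (show AffineOff V f.1 from f.2).polyOff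
      (show AffineOff V g.1 from g.2).polyOff x
    change Γ.slopeSum (fun y => f.1 y + g.1 y) x + (if x.1 = z then f.1 z + g.1 z else 0) = _
    rw [this]
    simp only [Pi.add_apply]
    split_ifs <;> ring
  map_smul' c f := by
    ext x
    change Γ.slopeSum (fun y => c * f.1 y) x + (if x.1 = z then c * f.1 z else 0) = _
    rw [slopeSum_const_mul]
    simp only [Pi.smul_apply, smul_eq_mul, RingHom.id_apply]
    split_ifs <;> ring

-- Slopes total zero, so only the correction at `z` survives. Adding it to the slopes thus removes
-- the constants from the kernel.
open Classical in
lemma ground_eq_sum_slopeMap (hV : Γ.branch ⊆ V) {z : Γ.Point} (hz : z ∈ V)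
    (f : affineOffSubmodule V) : ∑ x, slopeMap V z f x = f.1 z := by
  have h1 : ∑ x : V, slopeMap V z f x =
      ∑ x ∈ V, (Γ.slopeSum f.1 x + if x = z then f.1 z else 0) :=
    Finset.sum_coe_sort V fun x => Γ.slopeSum f.1 x + if x = z then f.1 z else 0
  rw [h1, Finset.sum_add_distrib, AffineOff.sum_slopeSum hV f.2, zero_add,
    Finset.sum_ite_eq' V z, if_pos hz]

/-- An element of the kernel vanishes at `z`, so all its slopes vanish; by Green it has zero energy
and is constant. -/
lemma slopeMap_injective (hV : Γ.branch ⊆ V) {z : Γ.Point} (hz : z ∈ V) :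
    Function.Injective (slopeMap V z) := by
  classical
  rw [injective_iff_map_eq_zero]
  intro f hf
  have hfa : AffineOff V f.1 := f.2
  have hfz : f.1 z = 0 := by
    rw [← ground_eq_sum_slopeMap hV hz f, hf]
    simp
  have hslope : ∀ x ∈ V, Γ.slopeSum f.1 x = 0 := by
    intro x hx
    have : slopeMap V z f ⟨x, hx⟩ = 0 := by rw [hf]; rfl
    simpa [slopeMap, hfz] using this
  have hen : energy (fun _ => 1) f.1 f.1 = 0 := by
    rw [hfa.energy_eq hV hfa.polyOff, Finset.sum_eq_zero, neg_zero]
    intro x hx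
    rw [hslope x hx, zero_mul]
  ext x
  rw [eq_of_energy_self_eq_zero hfa.isPiecewisePoly hen x z, hfz]
  rfl

lemma slopeMap_surjective (hV : Γ.branch ⊆ V) {z : Γ.Point} (hz : z ∈ V) :
    Function.Surjective (slopeMap V z) := by
  classical
  have hinj := slopeMap_injective hV hz
  have : FiniteDimensional ℝ (affineOffSubmodule V) := Module.Finite.of_injective _ hinj
  let ρ : affineOffSubmodule V →ₗ[ℝ] (V → ℝ) :=
    { toFun := fun f x => f.1 x
      map_add' := fun _ _ => rfl
      map_smul' := fun _ _ => rfl }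
  have hρ : Function.Surjective ρ := by
    intro w
    obtain ⟨f, hf, hw⟩ := exists_affineOff_eq hV fun x => if h : x ∈ V then w ⟨x, h⟩ else 0
    refine ⟨⟨f, hf⟩, ?_⟩
    ext x
    change f x = w x
    rw [hw x x.2]
    simp
  -- The dimension is at most `|V|` by injectivity, and at least `|V|` because values on `V` can be
  -- prescribed by interpolation.
  refine (LinearMap.injective_iff_surjective_of_finrank_eq_finrank (le_antisymm ?_ ?_)).1 hinj
  · exact LinearMap.finrank_le_finrank_of_injective hinj
  · exact LinearMap.finrank_le_finrank_of_surjective hρ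

lemma exists_isVoltage (hV : Γ.branch ⊆ V) {z y : Γ.Point} (hz : z ∈ V) (hy : y ∈ V) :
    ∃ f, Γ.IsVoltage z y f ∧ AffineOff V f := by
  classical
  -- The prescribed data total zero, which forces `f z = 0`.
  obtain ⟨f, hf⟩ := slopeMap_surjective hV hz fun x =>
    (if x.1 = z then 1 else 0) - (if x.1 = y then 1 else 0)
  have hfa : AffineOff V f.1 := f.2
  have hfz : f.1 z = 0 := by
    rw [← ground_eq_sum_slopeMap hV hz f, hf]
    rw [Finset.sum_coe_sort V fun x => (if x = z then (1 : ℝ) else 0) - (if x = y then 1 else 0)]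
    simp [hz, hy]
  refine ⟨f.1, ⟨hfa.cont, ⟨V, V.finite_toSet, hfa.affine⟩, fun x => ?_, hfz⟩, hfa⟩
  by_cases hx : x ∈ V
  · have := congrFun hf ⟨x, hx⟩
    simpa [slopeMap, hfz] using this
  · rw [hfa.polyOff.slopeSum_eq_zero hV hx, if_neg (by rintro rfl; exact hx hz),
      if_neg (by rintro rfl; exact hx hy), sub_zero]

end Existence

/-! ### Voltage and resistance through the weak equation. -/

section Voltage

/-- The weak form of the equation satisfied by a voltage function. -/
lemma IsVoltage.energy_eq {z y : Γ.Point} {f : Γ.Point → ℝ} (hf : Γ.IsVoltage z y f)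
    {g : Γ.Point → ℝ} (hg : IsPiecewisePoly g) :
    energy (fun _ => 1) f g = g y - g z := by
  classical
  obtain ⟨S, hS, haff⟩ := hf.locally_affine
  obtain ⟨W, hW⟩ := hg
  let V : Finset Γ.Point := Γ.branch ∪ hS.toFinset ∪ W ∪ {z, y}
  have hfa : AffineOff V f := ⟨hf.continuous, fun e t ht hn => haff e t ht fun h => hn (by
    simp [V, h])⟩
  have hgV : PolyOff V g := hW.mono fun x hx => by simp [V, hx]
  have hz : z ∈ V := by simp [V]
  have hy : y ∈ V := by simp [V]
  rw [hfa.energy_eq (fun x hx => by simp [V, hx]) hgV]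
  simp_rw [hf.slopeSum_eq, sub_mul, ite_mul, one_mul, zero_mul]
  rw [Finset.sum_sub_distrib, Finset.sum_ite_eq' V z, Finset.sum_ite_eq' V y, if_pos hz,
    if_pos hy]
  ring

lemma IsVoltage.isPiecewisePoly {z y : Γ.Point} {f : Γ.Point → ℝ} (hf : Γ.IsVoltage z y f) :
    IsPiecewisePoly f := by
  obtain ⟨S, hS, haff⟩ := hf.locally_affine
  exact AffineOff.isPiecewisePoly (V := hS.toFinset) ⟨hf.continuous, fun e t ht hn =>
    haff e t ht fun h => hn (by simpa using h)⟩

lemma isVoltage_voltage (z y : Γ.Point) : Γ.IsVoltage z y (fun x => Γ.voltage z x y) := by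
  classical
  have h : ∃ f, Γ.IsVoltage z y f := by
    obtain ⟨f, hf, -⟩ := exists_isVoltage (V := Γ.branch ∪ {z, y}) (z := z) (y := y)
      Finset.subset_union_left (by simp) (by simp)
    exact ⟨f, hf⟩
  have : (fun x => Γ.voltage z x y) = h.choose := by
    ext x
    simp [voltage, h]
  rw [this]
  exact h.choose_spec

lemma isPiecewisePoly_voltage (z y : Γ.Point) : IsPiecewisePoly (fun x => Γ.voltage z x y) :=
  (isVoltage_voltage z y).isPiecewisePoly

lemma energy_voltage (z y : Γ.Point) {g : Γ.Point → ℝ} (hg : IsPiecewisePoly g) :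
    energy (fun _ => 1) (fun x => Γ.voltage z x y) g = g y - g z :=
  (isVoltage_voltage z y).energy_eq hg

lemma voltage_ground (z y : Γ.Point) : Γ.voltage z z y = 0 := (isVoltage_voltage z y).ground

/-- The voltage function is determined by the weak form of its equation. -/
lemma eq_voltage_of_energy_eq {z y : Γ.Point} {f : Γ.Point → ℝ} (hf : IsPiecewisePoly f)
    (h0 : f z = 0) (h : ∀ g, IsPiecewisePoly g → energy (fun _ => 1) f g = g y - g z)
    (x : Γ.Point) : Γ.voltage z x y = f x := by
  have hv := isPiecewisePoly_voltage z y
  have hd := hv.sub hf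
  have h1 : ∀ g, IsPiecewisePoly g →
      energy (fun _ => 1) g (fun x => Γ.voltage z x y - f x) = 0 := by
    intro g hg
    rw [energy_sub_right (isPiecewisePoly_const 1) hg hv hf, energy_comm, energy_voltage z y hg,
      energy_comm, h g hg, sub_self]
  have := eq_of_energy_self_eq_zero hd (h1 _ hd) x z
  simp only [voltage_ground, h0] at this
  linarith

/-- Testing each of the two voltages against the other computes the same energy. -/
lemma voltage_symm (z x y : Γ.Point) : Γ.voltage z x y = Γ.voltage z y x := by
  have h1 := energy_voltage z x (isPiecewisePoly_voltage z y)
  have h2 := energy_voltage z y (isPiecewisePoly_voltage z x)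
  rw [energy_comm] at h1
  simp only [voltage_ground, sub_zero] at h1 h2
  rw [← h1, ← h2]

/-- `IsVoltage` only provides some finite exceptional set; uniqueness identifies the voltage with
the solution constructed in the space for this explicit set. -/
lemma affineOff_voltage [DecidableEq Γ.Point] (z y : Γ.Point) :
    AffineOff (Γ.branch ∪ {z, y}) (fun x => Γ.voltage z x y) := by
  obtain ⟨f, hf, hfa⟩ := exists_isVoltage (V := Γ.branch ∪ {z, y}) (z := z) (y := y)
      Finset.subset_union_left (by simp) (by simp)
  have : (fun x => Γ.voltage z x y) = f := funext fun x =>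
    eq_voltage_of_energy_eq hf.isPiecewisePoly hf.ground (fun g hg => hf.energy_eq hg) x
  rwa [this]

/-- Change of the reference point of the voltage function. -/
lemma voltage_change_ground (z w x y : Γ.Point) :
    Γ.voltage w x y = Γ.voltage z x y - Γ.voltage z x w - Γ.voltage z w y + Γ.voltage z w w := by
  have h1 := isPiecewisePoly_voltage z y
  have h2 := isPiecewisePoly_voltage z w
  have hP : IsPiecewisePoly fun x => Γ.voltage z x y - Γ.voltage z x w := h1.sub h2
  have := eq_voltage_of_energy_eq (z := w) (y := y)
    (f := fun x => Γ.voltage z x y - Γ.voltage z x w - (Γ.voltage z w y - Γ.voltage z w w))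
    (hP.sub (isPiecewisePoly_const _)) (sub_self _) (fun g hg => ?_) x
  · rw [this]; ring
  · rw [energy_comm, energy_sub_right (isPiecewisePoly_const 1) hg hP (isPiecewisePoly_const _),
      energy_sub_right (isPiecewisePoly_const 1) hg h1 h2, energy_const_right, energy_comm,
      energy_voltage z y hg, energy_comm, energy_voltage z w hg]
    ring

/-- The voltage grounded at `z` is a Gram kernel for the energy, with resistance as squared
distance; this is the polarization identity. -/
lemma resistance_eq (z x y : Γ.Point) :
    Γ.resistance x y = Γ.resistance z x + Γ.resistance z y - 2 * Γ.voltage z x y := by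
  unfold resistance
  rw [voltage_change_ground z x y y, voltage_symm z y x]
  ring

lemma resistance_self (x : Γ.Point) : Γ.resistance x x = 0 := voltage_ground x x

lemma resistance_symm (x y : Γ.Point) : Γ.resistance x y = Γ.resistance y x := by
  rw [resistance_eq y x y, resistance_self]
  have : Γ.voltage y x y = 0 := by rw [voltage_symm, voltage_ground]
  rw [this]; ring

lemma resistance_eq_energy (x y : Γ.Point) : Γ.resistance x y =
    energy (fun _ => 1) (fun w => Γ.voltage x w y) (fun w => Γ.voltage x w y) := by
  rw [energy_voltage x y (isPiecewisePoly_voltage x y), voltage_ground, sub_zero]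
  rfl

lemma resistance_nonneg (x y : Γ.Point) : 0 ≤ Γ.resistance x y := by
  rw [resistance_eq_energy]
  exact energy_self_nonneg _

lemma resistance_pos {x y : Γ.Point} (h : x ≠ y) : 0 < Γ.resistance x y := by
  classical
  refine lt_of_le_of_ne (resistance_nonneg x y) fun h0 => ?_
  have hc := eq_of_energy_self_eq_zero (isPiecewisePoly_voltage x y)
    (by rw [← resistance_eq_energy, ← h0])
  -- A constant voltage would have zero energy against every function, contradicting the weak
  -- equation on a `g` that separates `x` from `y`.
  have hg : ∃ g : Γ.Point → ℝ, IsPiecewisePoly g ∧ g y - g x = 1 := by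
    obtain ⟨g, hg, hw⟩ := exists_affineOff_eq (V := Γ.branch ∪ {x, y}) Finset.subset_union_left
      fun w => if w = y then 1 else 0
    refine ⟨g, hg.isPiecewisePoly, ?_⟩
    rw [hw x (by simp), hw y (by simp), if_pos rfl, if_neg h, sub_zero]
  obtain ⟨g, hg, hgxy⟩ := hg
  have h1 := energy_voltage x y hg
  have h2 : (fun w => Γ.voltage x w y) = fun _ => Γ.voltage x x y := funext fun w => hc w x
  rw [h2, energy_comm, energy_const_right, hgxy] at h1
  exact zero_ne_one h1

/-- The resistance function is bounded by that from a fixed point. -/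
lemma resistance_le (z x y : Γ.Point) :
    Γ.resistance x y ≤ 2 * (Γ.resistance z x + Γ.resistance z y) := by
  have hx := isPiecewisePoly_voltage z x
  have hy := isPiecewisePoly_voltage z y
  have h1 := isPiecewisePoly_const (Γ := Γ) 1
  -- Nonnegativity of this energy bounds `-2 j_z(x, y)` by the sum of the two resistances from `z`.
  have h0 := energy_self_nonneg fun w => Γ.voltage z w x + Γ.voltage z w y
  rw [energy_add_right h1 (hx.add hy) hx hy, energy_comm, energy_voltage z x (hx.add hy),
    energy_comm, energy_voltage z y (hx.add hy)] at h0
  simp only [voltage_ground, voltage_symm z y x] at h0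
  have := resistance_eq z x y
  unfold resistance at *
  linarith

end Voltage

end MetrizedGraph

end

noncomputable section

namespace MetrizedGraph

variable {Γ : MetrizedGraph.{u}}

/-! ### The resistance function is piecewise polynomial. -/

section Resistance

open Polynomial in
/-- The resistance function on a subinterval of a segment that contains no branch point. -/
lemma resistance_path_mul [DecidableEq Γ.Point] (y : Γ.Point) {e : Γ.Edge} {a b t : ℝ}
    (ha : 0 ≤ a) (hab : a < b) (hb : b ≤ Γ.len e)
    (hgap : ∀ s ∈ Set.Ioo a b, Γ.path e s ∉ Γ.branch ∪ {y}) (ht : t ∈ Set.Icc a b) :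
    Γ.resistance y (Γ.path e t) * (b - a) =
      Γ.voltage y (Γ.path e t) (Γ.path e a) * (b - t) +
        Γ.voltage y (Γ.path e t) (Γ.path e b) * (t - a) + (t - a) * (b - t) := by
  rcases ht.1.eq_or_lt with rfl | hat
  · simp [resistance]
  rcases ht.2.eq_or_lt with rfl | htb
  · simp [resistance]
  have hsub : ∀ s ∈ Set.Icc a b, s ∈ Set.Icc 0 (Γ.len e) := fun s hs =>
    ⟨ha.trans hs.1, hs.2.trans hb⟩
  have htV := hgap t ⟨hat, htb⟩
  simp only [Finset.mem_union, Finset.mem_singleton, not_or] at htV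
  -- With the source at parameter `t`, the voltage is affine on either side of `t` and its slope
  -- drops by 1 there. Symmetry turns its values at `a` and `b` into the two voltages of the
  -- statement.
  set φ : ℝ → ℝ := fun s => Γ.voltage y (Γ.path e s) (Γ.path e t) with hφ
  have haff := affineOff_voltage y (Γ.path e t)
  have hcont : Continuous φ := haff.cont.comp (continuous_path e)
  have hnear : ∀ s ∈ Set.Ioo a b, s ≠ t → AffineNear φ s := by
    intro s hs hst
    have hsI := hsub s (Set.Ioo_subset_Icc_self hs)
    have hsV := hgap s hs
    simp only [Finset.mem_union, Finset.mem_singleton, not_or] at hsV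
    refine haff.affine e s (mem_Ioo_of_path_notMem_branch hsI hsV.1) ?_
    simp only [Finset.mem_union, Finset.mem_insert, Finset.mem_singleton, not_or]
    exact ⟨hsV.1, hsV.2, fun h => hst (eq_of_path_eq (hsub t ht) hsI h htV.1).2⟩
  obtain ⟨c₁, d₁, h₁⟩ := exists_affine_of_forall_Ioo hat hcont.continuousOn
    fun s hs => hnear s ⟨hs.1, hs.2.trans htb⟩ hs.2.ne
  obtain ⟨c₂, d₂, h₂⟩ := exists_affine_of_forall_Ioo htb hcont.continuousOn
    fun s hs => hnear s ⟨hat.trans hs.1, hs.2⟩ hs.1.ne'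
  have hd₁ := derivWithin_Iic_of_eqOn_polynomial (P := C c₁ + C d₁ * X) hat (by simpa using h₁)
  have hd₂ := derivWithin_Ici_of_eqOn_polynomial (P := C c₂ + C d₂ * X) htb (by simpa using h₂)
  have hslope := (isVoltage_voltage y (Γ.path e t)).slopeSum_eq (Γ.path e t)
  rw [slopeSum_path (hsub t ht) htV.1, if_neg htV.2, if_pos rfl] at hslope
  change derivWithin φ _ _ - derivWithin φ _ _ = _ at hslope
  rw [hd₁, hd₂] at hslope
  simp only [Polynomial.derivative_add, Polynomial.derivative_C, Polynomial.derivative_mul,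
    Polynomial.derivative_X, Polynomial.eval_add, Polynomial.eval_mul, Polynomial.eval_C,
    Polynomial.eval_one, Polynomial.eval_zero] at hslope
  have ea : Γ.voltage y (Γ.path e t) (Γ.path e a) = c₁ + d₁ * a := by
    rw [voltage_symm]; exact h₁ a ⟨le_rfl, hat.le⟩
  have eb : Γ.voltage y (Γ.path e t) (Γ.path e b) = c₂ + d₂ * b := by
    rw [voltage_symm]; exact h₂ b ⟨htb.le, le_rfl⟩
  have et : Γ.resistance y (Γ.path e t) = φ t := rfl
  have e₁ := h₁ t ⟨hat.le, le_rfl⟩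
  have e₂ := h₂ t ⟨le_rfl, htb.le⟩
  have hc₁ : c₁ = φ t - d₁ * t := by linarith
  have hc₂ : c₂ = φ t - d₂ * t := by linarith
  have hd : d₂ = d₁ - 1 := by linarith
  rw [ea, eb, et, hc₁, hc₂, hd]
  ring

lemma continuous_voltage (z y : Γ.Point) : Continuous fun x => Γ.voltage z x y :=
  (isVoltage_voltage z y).continuous

/-- Between breaks, `resistance_path_mul` expresses the resistance by two voltages with fixed
sources, affine coefficients and a quadratic term. -/
lemma polyOff_resistance [DecidableEq Γ.Point] (y : Γ.Point) :
    PolyOff (Γ.branch ∪ {y}) (fun x => Γ.resistance y x) := by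
  have hV : Γ.branch ⊆ Γ.branch ∪ {y} := Finset.subset_union_left
  refine ⟨continuous_of_forall_path fun e => ?_, fun e t ht hn => ?_⟩
  · suffices H : ∀ a b, a < b → 0 ≤ a → b ≤ Γ.len e →
        ContinuousOn (fun t => Γ.resistance y (Γ.path e t)) (Set.Icc a b) from
      H 0 (Γ.len e) (Γ.len_pos e) le_rfl le_rfl
    refine interval_induction (breaks (Γ.branch ∪ {y}) e) _ (fun a b hab hgap ha hb => ?_)
      fun a c b _ hac hcb h1 h2 ha hb => ?_
    · have hgap' : ∀ s ∈ Set.Ioo a b, Γ.path e s ∉ Γ.branch ∪ {y} := fun s hs hm =>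
        hgap s (mem_breaks.2 ⟨⟨ha.trans hs.1.le, hs.2.le.trans hb⟩, hm⟩) hs
      have hne : b - a ≠ 0 := by linarith
      have hc : Continuous fun t => (Γ.voltage y (Γ.path e t) (Γ.path e a) * (b - t) +
          Γ.voltage y (Γ.path e t) (Γ.path e b) * (t - a) + (t - a) * (b - t)) / (b - a) := by
        have h1 := (continuous_voltage y (Γ.path e a)).comp (continuous_path e)
        have h2 := (continuous_voltage y (Γ.path e b)).comp (continuous_path e)
        simp only [Function.comp_def] at h1 h2
        fun_prop
      refine hc.continuousOn.congr fun t ht => ?_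
      simp only
      rw [← resistance_path_mul y ha hab hb hgap' ht]
      field_simp
    · rw [← Set.Icc_union_Icc_eq_Icc hac.le hcb.le]
      exact (h1 ha (hcb.le.trans hb)).union_of_isClosed (h2 (ha.trans hac.le) hb) isClosed_Icc
        isClosed_Icc
  · obtain ⟨a, hat, ha, hgl⟩ := exists_gap_left (breaks (Γ.branch ∪ {y}) e) ht.1
    obtain ⟨b, htb, hb, hgr⟩ := exists_gap_right (breaks (Γ.branch ∪ {y}) e) ht.2
    have hgap : ∀ s ∈ Set.Ioo a b, Γ.path e s ∉ Γ.branch ∪ {y} := by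
      intro s hs hm
      have hm' := mem_breaks.2 ⟨⟨ha.trans hs.1.le, hs.2.le.trans hb⟩, hm⟩
      rcases lt_trichotomy s t with h | h | h
      · exact hgl s hm' ⟨hs.1, h⟩
      · exact hn (h ▸ hm)
      · exact hgr s hm' ⟨h, hs.2⟩
    have hab := hat.trans htb
    have hne : b - a ≠ 0 := by linarith
    have htb' : Γ.path e t ∉ Γ.branch := fun h => hn (hV h)
    have hp : ∀ c, c ∈ Set.Icc 0 (Γ.len e) → c ≠ t →
        PolyAt (fun s => Γ.voltage y (Γ.path e s) (Γ.path e c)) t := by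
      intro c hc hct
      refine ((affineOff_voltage y (Γ.path e c)).affine e t ht ?_).polyAt
      simp only [Finset.mem_union, Finset.mem_singleton, not_or] at hn
      simp only [Finset.mem_union, Finset.mem_insert, Finset.mem_singleton, not_or]
      exact ⟨hn.1, hn.2, fun h => hct
        (eq_of_path_eq (Set.Ioo_subset_Icc_self ht) hc h.symm htb').2⟩
    have hl : ∀ c d : ℝ, PolyAt (fun s => c + d * s) t := fun c d =>
      AffineNear.polyAt ⟨c, d, Eventually.of_forall fun _ => rfl⟩
    obtain ⟨P, hP⟩ := ((((hp a ⟨ha, by linarith⟩ hat.ne).mul (hl b (-1))).add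
      ((hp b ⟨by linarith, hb⟩ htb.ne').mul (hl (-a) 1))).add
      ((hl (-a) 1).mul (hl b (-1)))).mul (polyAt_const (b - a)⁻¹ t)
    refine ⟨P, ?_⟩
    filter_upwards [hP, Icc_mem_nhds hat htb] with s h1 h2
    rw [← h1, ← div_eq_mul_inv, eq_div_iff hne, resistance_path_mul y ha hab hb hgap h2]
    ring

lemma isPiecewisePoly_resistance (y : Γ.Point) : IsPiecewisePoly (fun x => Γ.resistance y x) := by
  classical
  exact ⟨_, polyOff_resistance y⟩

lemma continuous_resistance (y : Γ.Point) : Continuous fun x => Γ.resistance y x :=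
  (isPiecewisePoly_resistance y).continuous

lemma continuous_resistance_left (y : Γ.Point) : Continuous fun x => Γ.resistance x y := by
  simpa only [resistance_symm y] using continuous_resistance y

/-- Needed for Fubini. Comparison with a base point replaces joint continuity by continuity in one
variable and compactness. -/
lemma exists_resistance_le (Γ : MetrizedGraph.{u}) :
    ∃ C, ∀ x y, ‖Γ.resistance x y‖ ≤ C := by
  obtain ⟨z⟩ : Nonempty Γ.Point := inferInstance
  obtain ⟨C, hC⟩ := (isCompact_range (continuous_resistance z)).bddAbove
  refine ⟨2 * (C + C), fun x y => ?_⟩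
  rw [Real.norm_of_nonneg (resistance_nonneg x y)]
  have hx := hC ⟨x, rfl⟩
  have hy := hC ⟨y, rfl⟩
  have := resistance_le z x y
  simp only at hx hy
  linarith

end Resistance

end MetrizedGraph

/-! ### Integration against a difference of finite measures. -/

section SignedMeasure

variable {X : Type*} [MeasurableSpace X]

lemma integral_sub_toSignedMeasure (α β : Measure X) [IsFiniteMeasure α] [IsFiniteMeasure β]
    {f : X → ℝ} (hα : Integrable f α) (hβ : Integrable f β) :
    ∫ᵛ x, f x ∂•(α.toSignedMeasure - β.toSignedMeasure) = ∫ x, f x ∂α - ∫ x, f x ∂β := by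
  have hflip : ContinuousLinearMap.lsmul ℝ ℝ (E := ℝ) =
      (ContinuousLinearMap.lsmul ℝ ℝ (E := ℝ)).flip := by
    ext; simp
  have h : ∀ (ν : Measure X) [IsFiniteMeasure ν],
      ∫ᵛ x, f x ∂•ν.toSignedMeasure = ∫ x, f x ∂ν := by
    intro ν _
    rw [hflip, VectorMeasure.integral_toSignedMeasure]
  rw [VectorMeasure.integral_sub_vectorMeasure, h, h]
  · rw [VectorMeasure.Integrable, Measure.variation_toSignedMeasure]; exact hα
  · rw [VectorMeasure.Integrable, Measure.variation_toSignedMeasure]; exact hβ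

end SignedMeasure

end

noncomputable section

namespace MetrizedGraph

variable {Γ : MetrizedGraph.{u}}

/-! ### Signed measures with densities and point masses. -/

section Measure

/-- The finite measure on `Γ` with the density `max (w e) 0` on the segment `e` and the point masses
`max (m x) 0`, `x ∈ V`. -/
def posMeasure (w : Γ.Edge → ℝ → ℝ) (V : Finset Γ.Point) (m : Γ.Point → ℝ) : Measure Γ.Point :=
  (∑ e, ((volume.restrict (Set.Ioc 0 (Γ.len e))).withDensity
      fun t => ENNReal.ofReal (w e t)).map (Γ.path e)) +
    ∑ x ∈ V, ENNReal.ofReal (m x) • Measure.dirac x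

variable {w : Γ.Edge → ℝ → ℝ} {V : Finset Γ.Point} {m : Γ.Point → ℝ}

lemma isFiniteMeasure_posMeasure
    (hw : ∀ e, IntegrableOn (w e) (Set.Ioc 0 (Γ.len e))) :
    IsFiniteMeasure (posMeasure w V m) := by
  have h1 : ∀ e, IsFiniteMeasure (((volume.restrict (Set.Ioc 0 (Γ.len e))).withDensity
      fun t => ENNReal.ofReal (w e t)).map (Γ.path e)) := fun e => by
    have := isFiniteMeasure_withDensity_ofReal (hw e).2
    infer_instance
  have h2 : ∀ x : Γ.Point, IsFiniteMeasure (ENNReal.ofReal (m x) • Measure.dirac x) := fun x =>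
    Measure.smul_finite _ ENNReal.ofReal_ne_top
  unfold posMeasure
  infer_instance

lemma integrable_of_continuous {f : Γ.Point → ℝ} (hf : Continuous f) (μ : Measure Γ.Point)
    [IsFiniteMeasure μ] : Integrable f μ := by
  obtain ⟨C, hC⟩ := (isCompact_range hf).isBounded.exists_norm_le
  exact Integrable.of_bound hf.measurable.aestronglyMeasurable C
    (Eventually.of_forall fun x => hC _ ⟨x, rfl⟩)

lemma integral_posMeasure (hw : ∀ e, IntegrableOn (w e) (Set.Ioc 0 (Γ.len e)))
    {g : Γ.Point → ℝ} (hg : Continuous g) :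
    ∫ x, g x ∂(posMeasure w V m) =
      (∑ e, ∫ t in Set.Ioc 0 (Γ.len e), max (w e t) 0 * g (Γ.path e t)) +
        ∑ x ∈ V, max (m x) 0 * g x := by
  have h1 : ∀ e, IsFiniteMeasure (((volume.restrict (Set.Ioc 0 (Γ.len e))).withDensity
      fun t => ENNReal.ofReal (w e t)).map (Γ.path e)) := fun e => by
    have := isFiniteMeasure_withDensity_ofReal (hw e).2
    infer_instance
  have h2 : ∀ x : Γ.Point, IsFiniteMeasure (ENNReal.ofReal (m x) • Measure.dirac x) := fun x =>
    Measure.smul_finite _ ENNReal.ofReal_ne_top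
  unfold posMeasure
  rw [integral_add_measure (integrable_of_continuous hg _) (integrable_of_continuous hg _),
    integral_finsetSum_measure fun e _ => integrable_of_continuous hg _,
    integral_finsetSum_measure fun e _ => integrable_of_continuous hg _]
  congr 1
  · refine Finset.sum_congr rfl fun e _ => ?_
    rw [integral_map (continuous_path e).measurable.aemeasurable
        hg.measurable.aestronglyMeasurable,
      integral_withDensity_eq_integral_toReal_smul₀ (hw e).1.aemeasurable.ennreal_ofReal
        (Eventually.of_forall fun _ => ENNReal.ofReal_lt_top)]
    refine integral_congr_ae (Eventually.of_forall fun t => ?_)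
    simp [ENNReal.toReal_ofReal']
  · refine Finset.sum_congr rfl fun x _ => ?_
    rw [integral_smul_measure, integral_dirac' _ _ hg.measurable.stronglyMeasurable]
    simp [ENNReal.toReal_ofReal']

/-- Integration against the signed measure with densities `w e` and point masses `m x`. -/
def pairing (w : Γ.Edge → ℝ → ℝ) (V : Finset Γ.Point) (m : Γ.Point → ℝ) (g : Γ.Point → ℝ) : ℝ :=
  (∑ e, ∫ t in Set.Ioc 0 (Γ.len e), w e t * g (Γ.path e t)) + ∑ x ∈ V, m x * g x

lemma integrableOn_mul_comp_path {w : ℝ → ℝ} {e : Γ.Edge}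
    (hw : IntegrableOn w (Set.Ioc 0 (Γ.len e))) {g : Γ.Point → ℝ} (hg : Continuous g) :
    IntegrableOn (fun t => w t * g (Γ.path e t)) (Set.Ioc 0 (Γ.len e)) := by
  obtain ⟨C, hC⟩ := (isCompact_range hg).isBounded.exists_norm_le
  exact hw.mul_bdd (c := C) (hg.comp (continuous_path e)).aestronglyMeasurable
    (Eventually.of_forall fun x => hC _ ⟨_, rfl⟩)

/-- The measure is the difference of those built from the positive and negative parts of the
densities and masses. -/
lemma exists_signedMeasure (hw : ∀ e, IntegrableOn (w e) (Set.Ioc 0 (Γ.len e)))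
    (V : Finset Γ.Point) (m : Γ.Point → ℝ) :
    ∃ μ : SignedMeasure Γ.Point, μ Set.univ = pairing w V m (fun _ => 1) ∧
      ∀ g, Continuous g → ∫ᵛ x, g x ∂•μ = pairing w V m g := by
  have hw' : ∀ e, IntegrableOn (fun t => -w e t) (Set.Ioc 0 (Γ.len e)) := fun e => (hw e).neg
  have hfin := isFiniteMeasure_posMeasure (V := V) (m := m) hw
  have hfin' := isFiniteMeasure_posMeasure (V := V) (m := fun x => -m x) hw'
  have hmax : ∀ r : ℝ, max r 0 - max (-r) 0 = r := fun r => by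
    rcases le_total 0 r with h | h
    · rw [max_eq_left h, max_eq_right (by linarith), sub_zero]
    · rw [max_eq_right h, max_eq_left (by linarith)]; ring
  have key : ∀ g, Continuous g → ∫ x, g x ∂(posMeasure w V m) -
      ∫ x, g x ∂(posMeasure (fun e t => -w e t) V fun x => -m x) = pairing w V m g := by
    intro g hg
    rw [integral_posMeasure hw hg, integral_posMeasure hw' hg, add_sub_add_comm,
      ← Finset.sum_sub_distrib, ← Finset.sum_sub_distrib]
    unfold pairing
    congr 1
    · refine Finset.sum_congr rfl fun e _ => ?_
      rw [← integral_sub (integrableOn_mul_comp_path (hw e).pos_part hg)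
        (integrableOn_mul_comp_path (hw' e).pos_part hg)]
      refine integral_congr_ae (Eventually.of_forall fun t => ?_)
      simp only
      rw [← sub_mul, hmax]
    · refine Finset.sum_congr rfl fun x _ => ?_
      rw [← sub_mul, hmax]
  refine ⟨(posMeasure w V m).toSignedMeasure -
    (posMeasure (fun e t => -w e t) V fun x => -m x).toSignedMeasure, ?_, fun g hg => ?_⟩
  · rw [← key _ continuous_const, Measure.toSignedMeasure_sub_apply MeasurableSet.univ]
    simp
  · rw [integral_sub_toSignedMeasure _ _ (integrable_of_continuous hg _)
      (integrable_of_continuous hg _), key g hg]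

/-- Fubini's theorem for the resistance kernel. -/
lemma integral_pairing_resistance (hw : ∀ e, IntegrableOn (w e) (Set.Ioc 0 (Γ.len e)))
    (α : Measure Γ.Point) [IsFiniteMeasure α] :
    ∫ ζ, pairing w V m (fun x => Γ.resistance ζ x) ∂α =
        pairing w V m (fun x => ∫ ζ, Γ.resistance ζ x ∂α) ∧
      ∀ e, IntegrableOn (fun t => w e t * ∫ ζ, Γ.resistance ζ (Γ.path e t) ∂α)
        (Set.Ioc 0 (Γ.len e)) := by
  obtain ⟨C, hC⟩ := Γ.exists_resistance_le
  -- Joint measurability from continuity in `t` and measurability in `ζ`.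
  have hmeas : ∀ e, Measurable fun p : Γ.Point × ℝ => Γ.resistance p.1 (Γ.path e p.2) := by
    intro e
    have := measurable_uncurry_of_continuous_of_measurable
      (u := fun (t : ℝ) (ζ : Γ.Point) => Γ.resistance ζ (Γ.path e t))
      (fun ζ => (continuous_resistance ζ).comp (continuous_path e))
      (fun t => (continuous_resistance_left (Γ.path e t)).measurable)
    exact this.comp measurable_swap
  have hint : ∀ e, Integrable (Function.uncurry fun (ζ : Γ.Point) (t : ℝ) =>
      w e t * Γ.resistance ζ (Γ.path e t)) (α.prod (volume.restrict (Set.Ioc 0 (Γ.len e)))) := by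
    intro e
    exact ((hw e).comp_snd α).mul_bdd (c := C) (hmeas e).aestronglyMeasurable
      (Eventually.of_forall fun p => hC _ _)
  have hr : ∀ x, Integrable (fun ζ => Γ.resistance ζ x) α := fun x =>
    integrable_of_continuous (continuous_resistance_left x) α
  refine ⟨?_, fun e => ?_⟩
  · have hint' : ∀ e, Integrable (fun ζ => ∫ t in Set.Ioc 0 (Γ.len e),
        w e t * Γ.resistance ζ (Γ.path e t)) α := fun e => (hint e).integral_prod_left
    unfold pairing
    simp only
    rw [integral_add (integrable_finsetSum _ fun e _ => hint' e)
        (integrable_finsetSum _ fun x _ => (hr x).const_mul _),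
      integral_finsetSum _ fun e _ => hint' e,
      integral_finsetSum _ fun x _ => (hr x).const_mul _]
    congr 1
    · refine Finset.sum_congr rfl fun e _ => ?_
      rw [integral_integral_swap (hint e)]
      refine integral_congr_ae (Eventually.of_forall fun t => ?_)
      simp only
      rw [integral_const_mul]
    · refine Finset.sum_congr rfl fun x _ => ?_
      rw [integral_const_mul]
  · have := (hint e).integral_prod_right
    refine this.congr (Eventually.of_forall fun t => ?_)
    simp only [Function.uncurry_apply_pair]
    rw [integral_const_mul]

end Measure

/-! ### The tau constant as an energy. -/

section Tau

/-- The densities of the canonical measure. -/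
def canonicalDensity (y : Γ.Point) (e : Γ.Edge) (t : ℝ) : ℝ :=
  -(1 / 2) * deriv (deriv fun s => Γ.resistance y (Γ.path e s)) t

open Classical in
/-- The point masses of the canonical measure. -/
def canonicalMass (y x : Γ.Point) : ℝ :=
  -(1 / 2) * Γ.slopeSum (fun x => Γ.resistance y x) x + if x = y then 1 else 0

lemma integrableOn_canonicalDensity (y : Γ.Point) (e : Γ.Edge) :
    IntegrableOn (canonicalDensity y e) (Set.Ioc 0 (Γ.len e)) := by
  classical
  have := PiecewisePoly.intervalIntegrable_deriv_deriv_mul (Γ.len_pos e)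
    ((polyOff_resistance y).piecewisePoly e) (ψ := fun _ => 1) continuous_const
  rw [intervalIntegrable_iff_integrableOn_Ioc_of_le (Γ.len_pos e).le] at this
  simp only [mul_one] at this
  exact this.const_mul _

-- The data represent ½ Δr(y, ·) + δ_y, and Green's identity moves one derivative onto `g`.
open Classical in
lemma pairing_canonical (y : Γ.Point) {g : Γ.Point → ℝ} (hg : IsPiecewisePoly g) :
    pairing (canonicalDensity y) (Γ.branch ∪ {y}) (canonicalMass y) g =
      1 / 2 * energy (fun _ => 1) (fun x => Γ.resistance y x) g + g y := by
  obtain ⟨W, hW⟩ := hg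
  set V := Γ.branch ∪ {y} with hVdef
  have hbV : Γ.branch ⊆ V := Finset.subset_union_left
  have hρ : PolyOff V (fun x => Γ.resistance y x) := polyOff_resistance y
  have green := energy_add_integral_eq_neg_sum_slopeSum (hbV.trans Finset.subset_union_left)
    (hρ.mono (Finset.subset_union_left (s₂ := W))) (hW.mono (Finset.subset_union_right (s₁ := V)))
  rw [← Finset.sum_subset (Finset.subset_union_left (s₁ := V) (s₂ := W))
    (fun x _ hx => by rw [hρ.slopeSum_eq_zero hbV hx, zero_mul])] at green
  have h1 : ∑ e, ∫ t in Set.Ioc 0 (Γ.len e), canonicalDensity y e t * g (Γ.path e t) =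
      -(1 / 2) * ∑ e, ∫ t in (0 : ℝ)..Γ.len e,
        deriv (deriv fun s => Γ.resistance y (Γ.path e s)) t * g (Γ.path e t) := by
    rw [Finset.mul_sum]
    refine Finset.sum_congr rfl fun e _ => ?_
    rw [intervalIntegral.integral_of_le (Γ.len_pos e).le, ← integral_const_mul]
    simp only [canonicalDensity, mul_assoc]
  have h2 : ∑ x ∈ V, canonicalMass y x * g x =
      -(1 / 2) * ∑ x ∈ V, Γ.slopeSum (fun x => Γ.resistance y x) x * g x + g y := by
    simp only [canonicalMass, add_mul, Finset.sum_add_distrib, ite_mul, one_mul, zero_mul]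
    rw [Finset.sum_ite_eq' V y, if_pos (by simp [hVdef]), Finset.mul_sum]
    simp only [mul_assoc]
  unfold pairing
  rw [h1, h2]
  linarith

-- Expand r(x, ·) by polarization at `y`: the voltage term contributes -r(y, x), which cancels the
-- point mass at `y`, so `x` drops out.
open Classical in
lemma pairing_canonical_resistance (y x : Γ.Point) :
    pairing (canonicalDensity y) (Γ.branch ∪ {y}) (canonicalMass y) (fun z => Γ.resistance x z) =
      1 / 2 * energy (fun _ => 1) (fun x => Γ.resistance y x) (fun x => Γ.resistance y x) := by
  rw [pairing_canonical y (isPiecewisePoly_resistance x)]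
  have hy := isPiecewisePoly_resistance y
  have h1 := isPiecewisePoly_const (Γ := Γ) 1
  have hv := isPiecewisePoly_voltage y x
  have heq : (fun z => Γ.resistance x z) =
      fun z => (Γ.resistance y x + Γ.resistance y z) - 2 * Γ.voltage y z x := by
    ext z
    rw [resistance_eq y x z, voltage_symm]
  rw [heq, energy_sub_right h1 hy ((isPiecewisePoly_const _).add hy) (hv.const_mul 2),
    energy_add_right h1 hy (isPiecewisePoly_const _) hy, energy_const_right,
    energy_const_mul_right, energy_comm (g := fun x_1 => Γ.voltage y x_1 x),
    energy_voltage y x hy, resistance_self, resistance_symm x y]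
  ring

/-- The tau constant as an energy. -/
theorem tau_eq (y : Γ.Point) :
    Γ.tau = 1 / 4 * energy (fun _ => 1) (fun x => Γ.resistance y x)
      (fun x => Γ.resistance y x) := by
  classical
  set K := energy (fun _ => 1) (fun x => Γ.resistance y x) (fun x => Γ.resistance y x) with hK
  have hw := integrableOn_canonicalDensity y
  obtain ⟨μ, hμ1, hμ⟩ := exists_signedMeasure hw (Γ.branch ∪ {y}) (canonicalMass y)
  have hone : pairing (canonicalDensity y) (Γ.branch ∪ {y}) (canonicalMass y) (fun _ => 1) = 1 := by
    rw [pairing_canonical y (isPiecewisePoly_const 1), energy_const_right]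
    norm_num
  have hpot : ∀ x, Γ.measureVoltage μ x x = 1 / 2 * K := by
    intro x
    rw [hK, ← pairing_canonical_resistance y x]
    have : (fun z => Γ.resistance x z) = fun z => Γ.resistance z x :=
      funext fun z => resistance_symm x z
    rw [this]
    exact hμ _ (continuous_resistance_left x)
  have hex : ∃ c, ∃ μ, Γ.IsCanonicalMeasure μ ∧ ∀ x, 1 / 2 * Γ.measureVoltage μ x x = c :=
    ⟨1 / 4 * K, μ, ⟨hμ1.trans hone, fun x x' => by rw [hpot, hpot]⟩, fun x => by
      rw [hpot]; ring⟩
  -- The chosen constant `c` may come from any canonical measure `ν`; the double integral of the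
  -- resistance against `ν` and the explicit measure identifies it.
  obtain ⟨ν, ⟨hν1, -⟩, hν⟩ := hex.choose_spec
  have htau : Γ.tau = hex.choose := by simp only [tau, dif_pos hex]
  rw [htau]
  set c := hex.choose
  let j := ν.toJordanDecomposition
  have hνj : ν = j.posPart.toSignedMeasure - j.negPart.toSignedMeasure :=
    ν.toSignedMeasure_toJordanDecomposition.symm
  have hνr : ∀ x, ∫ ζ, Γ.resistance ζ x ∂j.posPart - ∫ ζ, Γ.resistance ζ x ∂j.negPart =
      2 * c := by
    intro x
    rw [← integral_sub_toSignedMeasure _ _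
      (integrable_of_continuous (continuous_resistance_left x) _)
      (integrable_of_continuous (continuous_resistance_left x) _), ← hνj, ← hν x]
    unfold measureVoltage resistance
    ring
  have hmass : j.posPart.real Set.univ - j.negPart.real Set.univ = 1 := by
    rw [← hν1, hνj, Measure.toSignedMeasure_sub_apply MeasurableSet.univ]
  obtain ⟨hp, hpi⟩ := integral_pairing_resistance (V := Γ.branch ∪ {y}) (m := canonicalMass y)
    hw j.posPart
  obtain ⟨hn, hni⟩ := integral_pairing_resistance (V := Γ.branch ∪ {y}) (m := canonicalMass y)
    hw j.negPart
  simp only [pairing_canonical_resistance] at hp hn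
  rw [integral_const, smul_eq_mul] at hp hn
  -- In this order of integration the inner integral is the constant `2 * c`, and the explicit
  -- measure has total mass 1.
  have hdiff : pairing (canonicalDensity y) (Γ.branch ∪ {y}) (canonicalMass y)
        (fun x => ∫ ζ, Γ.resistance ζ x ∂j.posPart) -
      pairing (canonicalDensity y) (Γ.branch ∪ {y}) (canonicalMass y)
        (fun x => ∫ ζ, Γ.resistance ζ x ∂j.negPart) = 2 * c := by
    rw [← mul_one (2 * c), ← hone]
    unfold pairing
    rw [add_sub_add_comm, ← Finset.sum_sub_distrib, ← Finset.sum_sub_distrib, mul_add,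
      Finset.mul_sum, Finset.mul_sum]
    congr 1
    · refine Finset.sum_congr rfl fun e _ => ?_
      rw [← integral_sub (hpi e) (hni e), ← integral_const_mul]
      refine integral_congr_ae (Eventually.of_forall fun t => ?_)
      simp only
      rw [← mul_sub, hνr]
      ring
    · refine Finset.sum_congr rfl fun x _ => ?_
      rw [← mul_sub, hνr]
      ring
  rw [← hp, ← hn, ← sub_mul, hmass] at hdiff
  linarith

end Tau

end MetrizedGraph

end

noncomputable section

namespace MetrizedGraph

/-! ### Resistance after gluing at two points. -/

section Gluing

/-- The metrized graph `Γ` is obtained from `Γ₁` and `Γ₂` by identifying `p₁` with `p₂` and `q₁`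
with `q₂`, as far as piecewise polynomial functions and energies are concerned. -/
structure IsGluing {Γ₁ Γ₂ Γ : MetrizedGraph.{u}} (p₁ q₁ : Γ₁.Point) (p₂ q₂ : Γ₂.Point)
    (i₁ : Γ₁.Point → Γ.Point) (i₂ : Γ₂.Point → Γ.Point) : Prop where
  map_p : i₁ p₁ = i₂ p₂
  map_q : i₁ q₁ = i₂ q₂
  restrict_left : ∀ f : Γ.Point → ℝ, IsPiecewisePoly f → IsPiecewisePoly fun x => f (i₁ x)
  restrict_right : ∀ f : Γ.Point → ℝ, IsPiecewisePoly f → IsPiecewisePoly fun x => f (i₂ x)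
  energy_eq : ∀ h f g : Γ.Point → ℝ, energy h f g =
    energy (fun x => h (i₁ x)) (fun x => f (i₁ x)) (fun x => g (i₁ x)) +
      energy (fun x => h (i₂ x)) (fun x => f (i₂ x)) (fun x => g (i₂ x))
  glue : ∀ (f₁ : Γ₁.Point → ℝ) (f₂ : Γ₂.Point → ℝ), IsPiecewisePoly f₁ → IsPiecewisePoly f₂ →
    f₁ p₁ = f₂ p₂ → f₁ q₁ = f₂ q₂ →
      ∃ f : Γ.Point → ℝ, IsPiecewisePoly f ∧ (∀ x, f (i₁ x) = f₁ x) ∧ ∀ x, f (i₂ x) = f₂ x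

variable {Γ₁ Γ₂ Γ : MetrizedGraph.{u}} {p₁ q₁ : Γ₁.Point} {p₂ q₂ : Γ₂.Point}
  {i₁ : Γ₁.Point → Γ.Point} {i₂ : Γ₂.Point → Γ.Point}

lemma IsGluing.symm (h : IsGluing p₁ q₁ p₂ q₂ i₁ i₂) : IsGluing p₂ q₂ p₁ q₁ i₂ i₁ where
  map_p := h.map_p.symm
  map_q := h.map_q.symm
  restrict_left := h.restrict_right
  restrict_right := h.restrict_left
  energy_eq k f g := by rw [h.energy_eq, add_comm]
  glue f₁ f₂ h₁ h₂ hp hq := by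
    obtain ⟨f, hf, h1, h2⟩ := h.glue f₂ f₁ h₂ h₁ hp.symm hq.symm
    exact ⟨f, hf, h2, h1⟩

/-- The effect of a gluing on the resistance to one of the two gluing points. -/
lemma IsGluing.resistance_eq (h : IsGluing p₁ q₁ p₂ q₂ i₁ i₂)
    (hR : Γ₁.resistance p₁ q₁ + Γ₂.resistance p₂ q₂ ≠ 0) (x : Γ₁.Point) :
    Γ.resistance (i₁ p₁) (i₁ x) = Γ₁.resistance p₁ x -
      (Γ₁.resistance p₁ q₁ + Γ₂.resistance p₂ q₂)⁻¹ *
        (Γ₁.voltage p₁ x q₁ * Γ₁.voltage p₁ x q₁) := by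
  set R := Γ₁.resistance p₁ q₁ + Γ₂.resistance p₂ q₂ with hRdef
  -- The current that takes the detour through `Γ₂`, fixed by equality of the potentials at `q`:
  -- j(q, x) - c r₁ = c r₂.
  set c := R⁻¹ * Γ₁.voltage p₁ x q₁ with hc
  have hv := isPiecewisePoly_voltage p₁ x
  have hu := isPiecewisePoly_voltage p₁ q₁
  have hu' := isPiecewisePoly_voltage p₂ q₂
  obtain ⟨f, hf, hf₁, hf₂⟩ := h.glue
    (fun w => Γ₁.voltage p₁ w x - c * Γ₁.voltage p₁ w q₁) (fun w => c * Γ₂.voltage p₂ w q₂)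
    (hv.sub (hu.const_mul c)) (hu'.const_mul c) (by simp [voltage_ground]) (by
      change Γ₁.voltage p₁ q₁ x - c * Γ₁.resistance p₁ q₁ = c * Γ₂.resistance p₂ q₂
      have : c * R = Γ₁.voltage p₁ q₁ x := by
        rw [hc, voltage_symm p₁ q₁ x]; field_simp
      rw [← this, hRdef]; ring)
  have hvolt : Γ.voltage (i₁ p₁) (i₁ x) (i₁ x) = f (i₁ x) := by
    refine eq_voltage_of_energy_eq hf (by rw [hf₁]; simp [voltage_ground]) (fun g hg => ?_) _
    have hg₁ := h.restrict_left g hg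
    have hg₂ := h.restrict_right g hg
    have h1 := isPiecewisePoly_const (Γ := Γ₁) 1
    -- The terms in `c` from the two sides cancel, since `g` takes the same values at the glued
    -- points.
    rw [h.energy_eq]
    simp only [hf₁, hf₂]
    rw [energy_comm, energy_sub_right h1 hg₁ hv (hu.const_mul c), energy_const_mul_right,
      energy_comm, energy_voltage p₁ x hg₁, energy_comm, energy_voltage p₁ q₁ hg₁, energy_comm,
      energy_const_mul_right, energy_comm, energy_voltage p₂ q₂ hg₂, h.map_p, h.map_q]
    ring
  unfold resistance
  rw [hvolt, hf₁, hc]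
  ring

end Gluing

/-! ### Energy of the corrected resistance function. -/

section EnergyComputation

variable {Γ : MetrizedGraph.{u}} (p q : Γ.Point)

lemma voltage_eq_resistance_sub (x : Γ.Point) :
    Γ.voltage x p q = Γ.resistance p x - Γ.voltage p x q := by
  have h1 := Γ.resistance_eq x p q
  have h2 := Γ.resistance_eq p x q
  rw [resistance_symm x p] at h1
  linarith

/-- The energy of the resistance function after a rank one correction. -/
lemma energy_resistance_sub (c : ℝ) :
    energy (fun _ => 1)
        (fun x => Γ.resistance p x - c * (Γ.voltage p x q * Γ.voltage p x q))
        (fun x => Γ.resistance p x - c * (Γ.voltage p x q * Γ.voltage p x q)) =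
      4 * Γ.tau - 4 * c * (Γ.resistance p q ^ 2 / 2 - Γ.A p q)
        + 4 / 3 * c ^ 2 * Γ.resistance p q ^ 3 := by
  have h1 := isPiecewisePoly_const (Γ := Γ) 1
  have hu := isPiecewisePoly_voltage p q
  have hρ := isPiecewisePoly_resistance p
  have hA : Γ.A p q = energy (fun x => Γ.resistance p x) (fun x => Γ.voltage p x q)
        (fun x => Γ.voltage p x q) -
      energy (fun x => Γ.voltage p x q) (fun x => Γ.voltage p x q) (fun x => Γ.voltage p x q) := by
    have h2 : Γ.A p q = energy (fun x => Γ.resistance p x + -1 * Γ.voltage p x q)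
        (fun x => Γ.voltage p x q) (fun x => Γ.voltage p x q) := by
      unfold A energy
      refine Finset.sum_congr rfl fun e _ => intervalIntegral.integral_congr fun t _ => ?_
      simp only
      rw [voltage_eq_resistance_sub]
      ring
    rw [h2, energy_add_left hρ (hu.const_mul (-1)) hu hu, energy_const_mul_left]
    ring
  have hr : Γ.voltage p q q = Γ.resistance p q := rfl
  set u : Γ.Point → ℝ := fun x => Γ.voltage p x q with hudef
  set ρ : Γ.Point → ℝ := fun x => Γ.resistance p x with hρdef
  set R := Γ.resistance p q
  have huq : u q = R := hr
  have hup : u p = 0 := voltage_ground p q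
  have hρq : ρ q = R := rfl
  have huu := hu.mul hu
  -- Pairing with `u` gives the increment from `p` to `q`. With the Leibniz rule this evaluates the
  -- integrals of `u u'²` and `u² u'²`, and relates that of `u ρ' u'` to that of `ρ u'²`.
  have hE : ∀ g, IsPiecewisePoly g → energy (fun _ => 1) g u = g q - g p := fun g hg => by
    rw [energy_comm]; exact energy_voltage p q hg
  have e1 : energy (fun _ => 1) (fun x => u x * u x) u = R ^ 2 := by
    rw [hE _ huu, huq, hup]; ring
  have e2 : energy (fun _ => 1) (fun x => (u x * u x) * u x) u = R ^ 3 := by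
    rw [hE _ (huu.mul hu), huq, hup]; ring
  have e3 : energy (fun _ => 1) (fun x => ρ x * u x) u = R ^ 2 := by
    rw [hE _ (hρ.mul hu), huq, hup, hρq]; ring
  have f1 : energy (fun _ => 1) (fun x => u x * u x) u = 2 * energy u u u := by
    rw [energy_mul h1 hu hu hu]; simp only [one_mul]; ring
  have f2 : energy (fun _ => 1) (fun x => (u x * u x) * u x) u =
      3 * energy (fun x => u x * u x) u u := by
    rw [energy_mul h1 huu hu hu]
    simp only [one_mul]
    rw [energy_mul hu hu hu hu]
    ring
  have f3 : energy (fun _ => 1) (fun x => ρ x * u x) u = energy u ρ u + energy ρ u u := by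
    rw [energy_mul h1 hρ hu hu]; simp only [one_mul]
  have f4 : energy (fun _ => 1) ρ (fun x => u x * u x) = 2 * energy u ρ u := by
    rw [energy_comm, energy_mul h1 hu hu hρ]; simp only [one_mul]
    rw [energy_comm u u ρ]
    ring
  have f5 : energy (fun _ => 1) (fun x => u x * u x) (fun x => u x * u x) =
      4 * energy (fun x => u x * u x) u u := by
    rw [energy_mul h1 hu hu huu]; simp only [one_mul]
    rw [energy_comm, energy_mul hu hu hu hu]
    ring
  have htau := Γ.tau_eq p
  have hexp : energy (fun _ => 1) (fun x => ρ x - c * (u x * u x)) (fun x => ρ x - c * (u x * u x))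
      = energy (fun _ => 1) ρ ρ - 2 * c * energy (fun _ => 1) ρ (fun x => u x * u x) +
        c ^ 2 * energy (fun _ => 1) (fun x => u x * u x) (fun x => u x * u x) := by
    have hd := hρ.sub (huu.const_mul c)
    rw [energy_sub_right h1 hd hρ (huu.const_mul c), energy_const_mul_right,
      energy_comm (g := ρ), energy_comm (g := fun x => u x * u x),
      energy_sub_right h1 hρ hρ (huu.const_mul c), energy_sub_right h1 huu hρ (huu.const_mul c),
      energy_const_mul_right, energy_const_mul_right,
      energy_comm (f := fun x => u x * u x) (g := ρ)]
    ring
  change energy (fun _ => 1) (fun x => ρ x - c * (u x * u x)) (fun x => ρ x - c * (u x * u x)) = _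
  rw [hexp, f4, f5]
  have htau' : energy (fun _ => 1) ρ ρ = 4 * Γ.tau := by rw [htau]; ring
  rw [htau', hA]
  have g1 : energy u u u = R ^ 2 / 2 := by linarith
  have g2 : energy (fun x => u x * u x) u u = R ^ 3 / 3 := by linarith
  have g3 : energy u ρ u = R ^ 2 - energy ρ u u := by linarith
  rw [g1, g2, g3]
  ring

end EnergyComputation

/-! ### The union as a gluing. -/

section Union

variable {Γ₁ Γ₂ : MetrizedGraph.{u}} {p₁ q₁ : Γ₁.Point} {p₂ q₂ : Γ₂.Point}

/-- The inclusion of the first graph in the union. -/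
def unionInl (h₁ : p₁ ≠ q₁) (h₂ : p₂ ≠ q₂) (x : Γ₁.Point) : (Γ₁.union Γ₂ h₁ h₂).Point :=
  Quotient.mk (unionSetoid Γ₁ Γ₂ h₁ h₂) (.inl x)

/-- The inclusion of the second graph in the union. -/
def unionInr (h₁ : p₁ ≠ q₁) (h₂ : p₂ ≠ q₂) (x : Γ₂.Point) : (Γ₁.union Γ₂ h₁ h₂).Point :=
  Quotient.mk (unionSetoid Γ₁ Γ₂ h₁ h₂) (.inr x)

variable (h₁ : p₁ ≠ q₁) (h₂ : p₂ ≠ q₂)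

lemma unionInl_injective : Function.Injective (unionInl h₁ h₂) := by
  intro x y hxy
  rcases Quotient.exact hxy with h | h | h | h | h <;> simp_all

lemma unionInr_injective : Function.Injective (unionInr h₁ h₂) := by
  intro x y hxy
  rcases Quotient.exact hxy with h | h | h | h | h <;> simp_all

lemma continuous_unionInl : Continuous (unionInl h₁ h₂ : Γ₁.Point → (Γ₁.union Γ₂ h₁ h₂).Point) :=
  continuous_of_forall_path fun e =>
    ((Γ₁.union Γ₂ h₁ h₂).continuous_path (Sum.inl e)).continuousOn

lemma continuous_unionInr : Continuous (unionInr h₁ h₂ : Γ₂.Point → (Γ₁.union Γ₂ h₁ h₂).Point) :=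
  continuous_of_forall_path fun e =>
    ((Γ₁.union Γ₂ h₁ h₂).continuous_path (Sum.inr e)).continuousOn

lemma isGluing_union : IsGluing p₁ q₁ p₂ q₂ (unionInl h₁ h₂) (unionInr h₁ h₂) where
  map_p := Quotient.sound (.inr (.inl ⟨rfl, rfl⟩))
  map_q := Quotient.sound (.inr (.inr (.inr (.inl ⟨rfl, rfl⟩))))
  restrict_left f hf := by
    obtain ⟨V, hV⟩ := hf
    refine ⟨V.preimage _ (unionInl_injective h₁ h₂).injOn,
      hV.cont.comp (continuous_unionInl h₁ h₂), fun e t ht hn => ?_⟩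
    exact hV.poly (Sum.inl e) t ht fun h => hn (Finset.mem_preimage.2 h)
  restrict_right f hf := by
    obtain ⟨V, hV⟩ := hf
    refine ⟨V.preimage _ (unionInr_injective h₁ h₂).injOn,
      hV.cont.comp (continuous_unionInr h₁ h₂), fun e t ht hn => ?_⟩
    exact hV.poly (Sum.inr e) t ht fun h => hn (Finset.mem_preimage.2 h)
  energy_eq h f g := Fintype.sum_sum_type _
  glue f₁ f₂ hf₁ hf₂ hp hq := by
    classical
    obtain ⟨V₁, hV₁⟩ := hf₁
    obtain ⟨V₂, hV₂⟩ := hf₂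
    let f : (Γ₁.union Γ₂ h₁ h₂).Point → ℝ := Quotient.lift (Sum.elim f₁ f₂) (by
      rintro a b (rfl | ⟨rfl, rfl⟩ | ⟨rfl, rfl⟩ | ⟨rfl, rfl⟩ | ⟨rfl, rfl⟩)
      · rfl
      · exact hp
      · exact hp.symm
      · exact hq
      · exact hq.symm)
    refine ⟨f, ⟨V₁.image (unionInl h₁ h₂) ∪ V₂.image (unionInr h₁ h₂), ?_, ?_⟩,
      fun _ => rfl, fun _ => rfl⟩
    · refine continuous_of_forall_path ?_
      rintro (e | e)
      · exact (hV₁.cont.comp (continuous_path e)).continuousOn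
      · exact (hV₂.cont.comp (continuous_path e)).continuousOn
    · rintro (e | e) t ht hn
      · exact hV₁.poly e t ht fun h =>
          hn (Finset.mem_union_left _ (Finset.mem_image_of_mem (unionInl h₁ h₂) h))
      · exact hV₂.poly e t ht fun h =>
          hn (Finset.mem_union_right _ (Finset.mem_image_of_mem (unionInr h₁ h₂) h))

end Union

end MetrizedGraph

end

/-! ### The tau constant of the union. -/

theorem mainTheorem2 (Γ₁ Γ₂ : MetrizedGraph.{u}) {p₁ q₁ : Γ₁.Point} {p₂ q₂ : Γ₂.Point}
    (h₁ : p₁ ≠ q₁) (h₂ : p₂ ≠ q₂) :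
    (Γ₁.union Γ₂ h₁ h₂).tau = Γ₁.tau + Γ₂.tau
      - (Γ₁.resistance p₁ q₁ + Γ₂.resistance p₂ q₂) / 6
      + (Γ₁.A p₁ q₁ + Γ₂.A p₂ q₂) / (Γ₁.resistance p₁ q₁ + Γ₂.resistance p₂ q₂) := by
  have hglue := MetrizedGraph.isGluing_union h₁ h₂
  have hpos₁ := MetrizedGraph.resistance_pos h₁
  have hpos₂ := MetrizedGraph.resistance_pos h₂
  have hR : Γ₁.resistance p₁ q₁ + Γ₂.resistance p₂ q₂ ≠ 0 := by positivity
  have hr₁ := hglue.resistance_eq hR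
  have hr₂ := hglue.symm.resistance_eq (by rwa [add_comm])
  rw [add_comm (Γ₂.resistance p₂ q₂), ← hglue.map_p] at hr₂
  -- With the common image of `p₁` and `p₂` as base point, the same correction formula applies on
  -- both sides.
  rw [MetrizedGraph.tau_eq (MetrizedGraph.unionInl h₁ h₂ p₁), hglue.energy_eq]
  simp only [hr₁, hr₂]
  rw [MetrizedGraph.energy_resistance_sub, MetrizedGraph.energy_resistance_sub]
  -- The terms without tau and `A` combine through r₁³ + r₂³ = (r₁ + r₂)(r₁² - r₁r₂ + r₂²).
  field_simp
  ring
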